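/- Let $(M,g)$ be a smooth $n$-dimensional Riemannian manifold, let $T^*_0M$ be its cotangent bundle without the zero section, let $A\neq 0$ be a real constant and let $v:(0,\infty)\to\mathbb R$ be smooth. Let $(q^1,\dots,q^n,p_1,\dots,p_n)$ be the local coordinates on $T^*M$ induced by an arbitrary chart $(U,\varphi)$ of $M$ (so that $p=p_i\,dx^i$). The summation convention is used. Let $g_{ij}$ be the components of $g$, $(g^{kl})$ the inverse matrix, $\Gamma^k_{ij}$ the Christoffel symbols and $R^h_{kij}$ the components of the curvature tensor of the Levi-Civita connection, $R(\partial_i,\partial_j)\partial_k=R^h_{kij}\partial_h$ with $R(X,Y)=\nabla_X\nabla_Y-\nabla_Y\nabla_X-\nabla_{[X,Y]}$. Put $$t=\tfrac12 g^{ik}p_ip_k,\qquad g^{0i}=p_hg^{hi},\qquad \frac{\delta}{\delta q^i}=\frac{\partial}{\partial q^i}+p_k\Gamma^k_{ih}\frac{\partial}{\partial p_h},$$ $$G_{ij}=At\,g_{ij}+v(t)p_ip_j,\qquad H^{kl}=\frac1{At}g^{kl}+w(t)g^{0k}g^{0l},\qquad w=\frac{-v}{At^2(A+2v)}.$$ At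 the points of $T^*_0M$ where $A+2v(t)\neq0$ the matrix $(H^{kl})$ is the inverse of $(G_{ij})$. (The matrix $(G_{ij})$ is positive definite on $T^*_0M$ when $A>0$ and $A+2v>0$.) On the open set of these points let $J$ be the almost complex structure given, in the coordinates induced by any chart of $M$, by $$J\frac{\delta}{\delta q^i}=G_{ik}\frac{\partial}{\partial p_k},\qquad J\frac{\partial}{\partial p_i}=-H^{ik}\frac{\delta}{\delta q^k}.$$ Then, at every point of $T^*_0M$ over $U$ with $A+2v(t)\neq 0$, the Nijenhuis tensor field $N(X,Y)=[JX,JY]-J[JX,Y]-J[X,JY]-[X,Y]$ of $J$ is given, for all $i,j\in\{1,\dots,n\}$, by $$N\Big(\frac{\delta}{\delta q^i},\frac{\delta}{\delta q^j}\Big)=\{At(v+A)(\delta^h_ig_{jk}-\delta^h_jg_{ik})-R^h_{kij}\}\,p_h\frac{\partial}{\partial p_k},$$ $$N\Big(\frac{\delta}{\delta q^i},\frac{\partial}{\partial p_j}\Big)=H^{kl}H^{jr}\{At(v+A)(\delta^h_ig_{rl}-\delta^h_rg_{il})-R^h_{lir}\}\,p_h\frac{\delta}{\delta q^k},$$ $$N\Big(\frac{\partial}{\partial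 p_i},\frac{\partial}{\partial p_j}\Big)=H^{ir}H^{jl}\{At(v+A)(\delta^h_lg_{rk}-\delta^h_rg_{lk})-R^h_{klr}\}\,p_h\frac{\partial}{\partial p_k}.$$ -/

import Mathlib

open scoped Manifold ContDiff Bundle

noncomputable section

namespace CotangentNijenhuis

/-- The model space `ℝⁿ`. -/
abbrev E (n : ℕ) : Type := EuclideanSpace ℝ (Fin n)

/-- The cotangent bundle `T*M` of an `n`-dimensional manifold `M`, with its standard manifold
structure (the total space of the bundle of continuous linear forms on the tangent spaces). -/
abbrev Cotangent (n : ℕ) (M : Type*) [TopologicalSpace M] [ChartedSpace (E n) M]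
    [IsManifold 𝓘(ℝ, E n) ∞ M] : Type _ :=
  Bundle.TotalSpace (E n →L[ℝ] ℝ) (fun x : M => TangentSpace 𝓘(ℝ, E n) x →L[ℝ] ℝ)

/-- The model with corners of `T*M`. -/
abbrev IT (n : ℕ) := 𝓘(ℝ, E n).prod 𝓘(ℝ, E n →L[ℝ] ℝ)

/-- Smooth Riemannian metrics on `M`. -/
abbrev Metric (n : ℕ) (M : Type*) [TopologicalSpace M] [ChartedSpace (E n) M]
    [IsManifold 𝓘(ℝ, E n) ∞ M] : Type _ :=
  Bundle.ContMDiffRiemannianMetric 𝓘(ℝ, E n) ∞ (E n) (fun x : M => TangentSpace 𝓘(ℝ, E n) x)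

/-- The standard basis of `ℝⁿ`. -/
def stdVec {n : ℕ} (i : Fin n) : E n := EuclideanSpace.single i 1

/-- The partial derivative `∂f/∂xⁱ` of a function on (an open subset of) `ℝⁿ`. -/
def pderiv {n : ℕ} (i : Fin n) (f : E n → ℝ) (q : E n) : ℝ := fderiv ℝ f q (stdVec i)

section

variable {n : ℕ} {M : Type*} [TopologicalSpace M] [ChartedSpace (E n) M]
  [IsManifold 𝓘(ℝ, E n) ∞ M]

/-- The coordinate vector `∂/∂xⁱ` at `x`, for a chart `e` of `M` around `x`: the vector that the
differential of the chart sends to the `i`-th standard basis vector. -/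
def coordVec (e : OpenPartialHomeomorph M (E n)) (i : Fin n) (x : M) :
    TangentSpace 𝓘(ℝ, E n) x :=
  (mfderiv 𝓘(ℝ, E n) 𝓘(ℝ, E n) e x).inverse (stdVec i)

/-- The matrix `(g_ij)` of the metric in the chart `e`, as a function of the coordinates. -/
def gLow (g : Metric n M) (e : OpenPartialHomeomorph M (E n)) (q : E n) :
    Matrix (Fin n) (Fin n) ℝ :=
  Matrix.of fun i j => g.inner (e.symm q) (coordVec e i (e.symm q)) (coordVec e j (e.symm q))

/-- The inverse matrix `(g^kl)`. -/
def gUp (g : Metric n M) (e : OpenPartialHomeomorph M (E n)) (q : E n) :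
    Matrix (Fin n) (Fin n) ℝ :=
  (gLow g e q)⁻¹

/-- The Christoffel symbol `Γ^k_ij` of the Levi-Civita connection of `g` in the chart `e`. -/
def christoffel (g : Metric n M) (e : OpenPartialHomeomorph M (E n)) (k i j : Fin n) (q : E n) :
    ℝ :=
  (1 / 2) * ∑ l, gUp g e q k l *
    (pderiv i (fun y => gLow g e y j l) q + pderiv j (fun y => gLow g e y i l) q
      - pderiv l (fun y => gLow g e y i j) q)

/-- The components `R^h_kij` of the curvature tensor of `g` in the chart `e`, with the convention
`R(∂_i, ∂_j) ∂_k = R^h_kij ∂_h`, where `R(X, Y) = ∇_X ∇_Y - ∇_Y ∇_X - ∇_[X,Y]`. -/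
def curvature (g : Metric n M) (e : OpenPartialHomeomorph M (E n)) (h k i j : Fin n) (q : E n) :
    ℝ :=
  pderiv i (christoffel g e h j k) q - pderiv j (christoffel g e h i k) q
    + ∑ l, (christoffel g e h i l q * christoffel g e l j k q
      - christoffel g e h j l q * christoffel g e l i k q)

/-- The fibre coordinate `p_i` of a covector `P`, for a chart `e` around its base point:
`P = p_i dxⁱ`, i.e. `p_i = P(∂/∂xⁱ)`. -/
def fibreCoord (e : OpenPartialHomeomorph M (E n)) (i : Fin n) (P : Cotangent n M) : ℝ :=
  P.2 (coordVec e i P.1)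

/-- The chart `P ↦ (q¹, …, qⁿ, p_1, …, p_n)` of `T*M` induced by a chart `e` of `M`. -/
def cotChart (e : OpenPartialHomeomorph M (E n)) (P : Cotangent n M) : E n × E n :=
  (e P.1, WithLp.toLp 2 fun i => fibreCoord e i P)

/-- The differential at `P` of the induced chart. -/
def dChart (e : OpenPartialHomeomorph M (E n)) (P : Cotangent n M) :
    TangentSpace (IT n) P →L[ℝ] E n × E n :=
  mfderiv (IT n) 𝓘(ℝ, E n × E n) (cotChart e) P

/-- The coordinate vector field `∂/∂qⁱ` on `T*M`. -/
def dq_vec (e : OpenPartialHomeomorph M (E n)) (i : Fin n) (P : Cotangent n M) :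
    TangentSpace (IT n) P :=
  (dChart e P).inverse (stdVec i, 0)

/-- The coordinate vector field `∂/∂p_i` on `T*M`. -/
def dp_vec (e : OpenPartialHomeomorph M (E n)) (i : Fin n) (P : Cotangent n M) :
    TangentSpace (IT n) P :=
  (dChart e P).inverse (0, stdVec i)

/-- `Γ^0_ih = p_k Γ^k_ih`. -/
def christoffelZero (g : Metric n M) (e : OpenPartialHomeomorph M (E n)) (i h : Fin n)
    (P : Cotangent n M) : ℝ :=
  ∑ k, fibreCoord e k P * christoffel g e k i h (e P.1)

/-- The horizontal vector field `δ/δqⁱ = ∂/∂qⁱ + Γ^0_ih ∂/∂p_h`. -/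
def delta_vec (g : Metric n M) (e : OpenPartialHomeomorph M (E n)) (i : Fin n)
    (P : Cotangent n M) : TangentSpace (IT n) P :=
  dq_vec e i P + ∑ h, christoffelZero g e i h P • dp_vec e h P

/-- The 1-form `dqⁱ`. -/
def dq_form (e : OpenPartialHomeomorph M (E n)) (i : Fin n) (P : Cotangent n M) :
    TangentSpace (IT n) P →L[ℝ] ℝ :=
  (EuclideanSpace.proj i).comp ((ContinuousLinearMap.fst ℝ (E n) (E n)).comp (dChart e P))

/-- The 1-form `dp_i`. -/
def dp_form (e : OpenPartialHomeomorph M (E n)) (i : Fin n) (P : Cotangent n M) :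
    TangentSpace (IT n) P →L[ℝ] ℝ :=
  (EuclideanSpace.proj i).comp ((ContinuousLinearMap.snd ℝ (E n) (E n)).comp (dChart e P))

/-- The 1-form `Dp_i = dp_i - Γ^0_ij dq^j`; together with the `dqⁱ` these form the coframe dual to
`(δ/δqⁱ, ∂/∂p_i)`. -/
def Dp_form (g : Metric n M) (e : OpenPartialHomeomorph M (E n)) (i : Fin n)
    (P : Cotangent n M) : TangentSpace (IT n) P →L[ℝ] ℝ :=
  dp_form e i P - ∑ j, christoffelZero g e i j P • dq_form e j P

/-- The energy density `t = ½ g^ik p_i p_k`. -/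
def energy (g : Metric n M) (e : OpenPartialHomeomorph M (E n)) (P : Cotangent n M) : ℝ :=
  (1 / 2) * ∑ i, ∑ k, gUp g e (e P.1) i k * fibreCoord e i P * fibreCoord e k P

/-- `g^0i = p_h g^hi`. -/
def gZero (g : Metric n M) (e : OpenPartialHomeomorph M (E n)) (i : Fin n)
    (P : Cotangent n M) : ℝ :=
  ∑ h, fibreCoord e h P * gUp g e (e P.1) h i

/-- `G_ij = A t g_ij + v(t) p_i p_j`. -/
def GLow (g : Metric n M) (A : ℝ) (v : ℝ → ℝ) (e : OpenPartialHomeomorph M (E n)) (i j : Fin n)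
    (P : Cotangent n M) : ℝ :=
  A * energy g e P * gLow g e (e P.1) i j
    + v (energy g e P) * fibreCoord e i P * fibreCoord e j P

/-- `w(t) = -v(t) / (A t² (A + 2 v(t)))`. -/
def wFun (A : ℝ) (v : ℝ → ℝ) (t : ℝ) : ℝ := -v t / (A * t ^ 2 * (A + 2 * v t))

/-- `H^kl = (1 / (A t)) g^kl + w(t) g^0k g^0l`, the inverse matrix of `(G_ij)`. -/
def HUp (g : Metric n M) (A : ℝ) (v : ℝ → ℝ) (e : OpenPartialHomeomorph M (E n)) (k l : Fin n)
    (P : Cotangent n M) : ℝ :=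
  1 / (A * energy g e P) * gUp g e (e P.1) k l
    + wFun A v (energy g e P) * gZero g e k P * gZero g e l P

/-- The endomorphism of `T_P(T*M)` with `δ/δqⁱ ↦ G_ik ∂/∂p_k` and `∂/∂p_i ↦ -H^ik δ/δq^k`,
where the frame and the components are those of the chart `e` around the base point of `P`. -/
def JChart (g : Metric n M) (A : ℝ) (v : ℝ → ℝ) (e : OpenPartialHomeomorph M (E n))
    (P : Cotangent n M) : TangentSpace (IT n) P →L[ℝ] TangentSpace (IT n) P :=
  (∑ i, (dq_form e i P).smulRight (∑ k, GLow g A v e i k P • dp_vec e k P))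
    - ∑ i, (Dp_form g e i P).smulRight (∑ k, HUp g A v e i k P • delta_vec g e k P)

/-- The almost complex structure `J` of the nonzero cotangent bundle. The components `G_ij`,
`H^kl` and the adapted frames transform tensorially under changes of charts of `M`, so the value
of `J` at `P` may be read off in any chart around the base point of `P`; here the preferred chart
is taken. (The values of `J` on the zero section, where `t = 0`, are irrelevant.) -/
def J (g : Metric n M) (A : ℝ) (v : ℝ → ℝ) (P : Cotangent n M) :
    TangentSpace (IT n) P →L[ℝ] TangentSpace (IT n) P :=
  JChart g A v (chartAt (E n) P.1) P

/-- The Nijenhuis tensor field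
`N(X, Y) = [KX, KY] - K[KX, Y] - K[X, KY] - [X, Y]` of a field `K` of endomorphisms of the
tangent spaces of `T*M`. Its value at `P` depends only on the germs of the fields at `P`, so for
`P` outside the zero section this is the Nijenhuis tensor field on the open subset `T*₀M`. -/
def nijenhuis (K : (P : Cotangent n M) → TangentSpace (IT n) P →L[ℝ] TangentSpace (IT n) P)
    (X Y : (P : Cotangent n M) → TangentSpace (IT n) P) (P : Cotangent n M) :
    TangentSpace (IT n) P :=
  VectorField.mlieBracket (IT n) (fun Q => K Q (X Q)) (fun Q => K Q (Y Q)) P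
    - K P (VectorField.mlieBracket (IT n) (fun Q => K Q (X Q)) Y P)
    - K P (VectorField.mlieBracket (IT n) X (fun Q => K Q (Y Q)) P)
    - VectorField.mlieBracket (IT n) X Y P

/-- The Kronecker symbol `δ^h_i`. -/
def kron (h i : Fin n) : ℝ := if h = i then 1 else 0

/-- The contraction `{A t (v + A) (δ^h_i g_jk - δ^h_j g_ik) - R^h_kij} p_h`. -/
def T (g : Metric n M) (A : ℝ) (v : ℝ → ℝ) (e : OpenPartialHomeomorph M (E n)) (k i j : Fin n)
    (P : Cotangent n M) : ℝ :=
  ∑ h, (A * energy g e P * (v (energy g e P) + A)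
      * (kron h i * gLow g e (e P.1) j k - kron h j * gLow g e (e P.1) i k)
    - curvature g e h k i j (e P.1)) * fibreCoord e h P

end

end CotangentNijenhuis

end

/-! The Nijenhuis tensor is local and natural under diffeomorphisms, so it is computed in the chart
of `T*M` induced by `e`, on an open subset of `E n × E n`, from the matrices `a = (g_ij)`, `b =
(g^ij)` and the symbols `Γ` alone.

Write `δ_i` for `δ/δqⁱ`. Because the connection is metric, the energy `t` is constant along `δ_i`
(`fderiv_flatEnergy_flatHor`), hence `G` is parallel (`fderiv_flatG_flatHor`). With vanishing
torsion this makes the vertical fields `[Jδ_i, δ_j]` and `[δ_i, Jδ_j]` opposite at the point, so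
their `J`-images cancel in `N(δ_i, δ_j)`. There remains `[Jδ_i, Jδ_j] - [δ_i, δ_j]`: the second
bracket is the curvature, and the first follows from `dt(Jδ_i) = t(A + 2v)p_i`
(`sum_flatZero_mul_flatG`). This is `flatNijenhuis_flatHor_flatHor`.

The other two formulas need no new bracket. Since `H` inverts `G`, `∂/∂p_j = H^jr Jδ_r`; since `J² =
-1`, `N` is tensorial and `N(X, JY) = -J N(X, Y)`. Together these give `flatNijenhuis_ver_right`.

Returning to `T*M`, `J` is read at each point in the preferred chart there, which varies with the
point. To differentiate it, it must be identified near `P` with its expression in the fixed chart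
`e` (`JChart_eq`). This rests on the transformation law of the Christoffel symbols
(`sum_jacobian_mul_christoffel`), deduced from the uniqueness of the Levi-Civita connection. -/

open Bundle Filter Topology VectorField

noncomputable section

namespace CotangentNijenhuis

/-! ### Coordinate frames on `M` and the induced charts of `T*M`. -/

section Charts

variable {n : ℕ} {M : Type*} [TopologicalSpace M] [ChartedSpace (E n) M]
  [IsManifold 𝓘(ℝ, E n) ∞ M] {e : OpenPartialHomeomorph M (E n)}

omit [IsManifold 𝓘(ℝ, E n) ∞ M] in
theorem mdifferentiable_of_mem_maximalAtlas (he : e ∈ IsManifold.maximalAtlas 𝓘(ℝ, E n) ∞ M) :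
    e.MDifferentiable 𝓘(ℝ, E n) 𝓘(ℝ, E n) :=
  ⟨(contMDiffOn_of_mem_maximalAtlas he).mdifferentiableOn (by simp),
    (contMDiffOn_symm_of_mem_maximalAtlas he).mdifferentiableOn (by simp)⟩

omit [IsManifold 𝓘(ℝ, E n) ∞ M] in
theorem isInvertible_mfderiv (he : e ∈ IsManifold.maximalAtlas 𝓘(ℝ, E n) ∞ M) {x : M}
    (hx : x ∈ e.source) : (mfderiv 𝓘(ℝ, E n) 𝓘(ℝ, E n) e x).IsInvertible :=
  ⟨(mdifferentiable_of_mem_maximalAtlas he).mfderiv hx, rfl⟩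

omit [IsManifold 𝓘(ℝ, E n) ∞ M] in
theorem mfderiv_coordVec (he : e ∈ IsManifold.maximalAtlas 𝓘(ℝ, E n) ∞ M) {x : M}
    (hx : x ∈ e.source) (i : Fin n) :
    mfderiv 𝓘(ℝ, E n) 𝓘(ℝ, E n) e x (coordVec e i x) = stdVec i :=
  ((isInvertible_mfderiv he hx).inverse_apply_eq.1 rfl).symm

/-- The field is the pullback under `e` of a constant field on `ℝⁿ`, and pullbacks by maps with
invertible differential are smooth. -/
theorem contMDiffAt_coordVec (he : e ∈ IsManifold.maximalAtlas 𝓘(ℝ, E n) ∞ M) {x : M}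
    (hx : x ∈ e.source) (i : Fin n) :
    ContMDiffAt 𝓘(ℝ, E n) (𝓘(ℝ, E n).tangent) ∞
      (fun y => (⟨y, coordVec e i y⟩ : TangentBundle 𝓘(ℝ, E n) M)) x := by
  have hV : ContMDiffAt 𝓘(ℝ, E n) (𝓘(ℝ, E n).tangent) ∞
      (fun y : E n => (⟨y, stdVec i⟩ : TangentBundle 𝓘(ℝ, E n) (E n))) (e x) := by
    exact contMDiffAt_vectorSpace_iff_contDiffAt.2 contDiffAt_const
  exact ContMDiffAt.mpullback_vectorField_preimage (n := ∞) (f := e) (V := fun _ => stdVec i) hV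
    (contMDiffAt_of_mem_maximalAtlas he hx) (isInvertible_mfderiv he hx) (by simp)

omit [IsManifold 𝓘(ℝ, E n) ∞ M] in
theorem eq_sum_coordVec (he : e ∈ IsManifold.maximalAtlas 𝓘(ℝ, E n) ∞ M) {x : M}
    (hx : x ∈ e.source) (u : TangentSpace 𝓘(ℝ, E n) x) :
    u = ∑ i, (show E n from mfderiv 𝓘(ℝ, E n) 𝓘(ℝ, E n) e x u) i • coordVec e i x := by
  obtain ⟨f, hf⟩ := isInvertible_mfderiv he hx
  apply f.injective
  have h1 : ∀ u, f u = mfderiv 𝓘(ℝ, E n) 𝓘(ℝ, E n) e x u := fun u => by rw [← hf]; rfl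
  rw [map_sum, h1]
  simp_rw [map_smul, h1, mfderiv_coordVec he hx]
  refine PiLp.ext fun j => ?_
  change _ = (∑ i, (show E n from mfderiv 𝓘(ℝ, E n) 𝓘(ℝ, E n) e x u) i • stdVec i : E n) j
  simp [stdVec, Finset.sum_apply, Pi.single_apply]

/-- The coordinate 1-form `dxⁱ` on `M`. -/
def coordForm (e : OpenPartialHomeomorph M (E n)) (i : Fin n) (x : M) :
    TangentSpace 𝓘(ℝ, E n) x →L[ℝ] ℝ :=
  (EuclideanSpace.proj i : E n →L[ℝ] ℝ).comp (mfderiv 𝓘(ℝ, E n) 𝓘(ℝ, E n) e x)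

omit [IsManifold 𝓘(ℝ, E n) ∞ M] in
theorem coordForm_coordVec (he : e ∈ IsManifold.maximalAtlas 𝓘(ℝ, E n) ∞ M) {x : M}
    (hx : x ∈ e.source) (i j : Fin n) :
    coordForm e i x (coordVec e j x) = if i = j then 1 else 0 := by
  change (EuclideanSpace.proj i : E n →L[ℝ] ℝ) (mfderiv 𝓘(ℝ, E n) 𝓘(ℝ, E n) e x _) = _
  rw [mfderiv_coordVec he hx]
  simp [stdVec]

theorem contMDiffAt_coordForm (he : e ∈ IsManifold.maximalAtlas 𝓘(ℝ, E n) ∞ M) {x : M}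
    (hx : x ∈ e.source) (i : Fin n) :
    ContMDiffAt 𝓘(ℝ, E n) (IT n) ∞ (fun y => (⟨y, coordForm e i y⟩ : Cotangent n M)) x := by
  have he' := contMDiffAt_of_mem_maximalAtlas he hx
  rw [contMDiffAt_hom_bundle]
  refine ⟨contMDiffAt_id, ?_⟩
  have h := ContMDiffAt.mfderiv_const (m := ∞) he' (by simp)
  have h2 : ContMDiffAt 𝓘(ℝ, E n) 𝓘(ℝ, E n →L[ℝ] ℝ) ∞ (fun y =>
    (EuclideanSpace.proj i : E n →L[ℝ] ℝ).comp (inTangentCoordinates 𝓘(ℝ, E n) 𝓘(ℝ, E n) id e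
      (mfderiv 𝓘(ℝ, E n) 𝓘(ℝ, E n) e) x y)) x := by
    exact ContMDiffAt.clm_comp (g := fun _ => (EuclideanSpace.proj i : E n →L[ℝ] ℝ))
      contMDiffAt_const h
  refine h2.congr_of_eventuallyEq (Eventually.of_forall fun y => ?_)
  ext u
  simp [inTangentCoordinates, ContinuousLinearMap.inCoordinates, coordForm]
  rfl

theorem contMDiffAt_cotChart (he : e ∈ IsManifold.maximalAtlas 𝓘(ℝ, E n) ∞ M)
    {P : Cotangent n M} (hP : P.1 ∈ e.source) :
    ContMDiffAt (IT n) 𝓘(ℝ, E n × E n) ∞ (cotChart e) P := by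
  have hproj : ContMDiffAt (IT n) 𝓘(ℝ, E n) ∞ (fun Q : Cotangent n M => Q.1) P :=
    Bundle.contMDiffAt_proj _
  have h1 : ContMDiffAt (IT n) 𝓘(ℝ, E n) ∞ (fun Q : Cotangent n M => e Q.1) P :=
    (contMDiffAt_of_mem_maximalAtlas he hP).comp P hproj
  have h2 : ∀ i, ContMDiffAt (IT n) 𝓘(ℝ, ℝ) ∞ (fibreCoord (M := M) e i) P := by
    intro i
    have hv := (contMDiffAt_coordVec he hP i).comp P hproj
    -- The covector field along the projection is the tautological one `Q ↦ Q.2`, smooth because it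
    -- is the identity map of `T*M`.
    have := ContMDiffAt.clm_bundle_apply (F₁ := E n) (F₂ := ℝ) (n := ∞) (IB := 𝓘(ℝ, E n))
      (E₁ := fun x : M => TangentSpace 𝓘(ℝ, E n) x)
      (E₂ := Bundle.Trivial M ℝ) (b := fun Q : Cotangent n M => Q.1) (ϕ := fun Q => Q.2)
      (v := fun Q => coordVec e i Q.1) (x := P) (IM := IT n) contMDiffAt_id hv
    exact (Bundle.contMDiffAt_totalSpace.1 this).2
  have h3 : ContMDiffAt (IT n) 𝓘(ℝ, E n) ∞
      (fun Q : Cotangent n M => (WithLp.toLp 2 fun i => fibreCoord e i Q : E n)) P := by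
    have h4 : ContMDiffAt (IT n) 𝓘(ℝ, Fin n → ℝ) ∞
      (fun Q : Cotangent n M => (fun i => fibreCoord e i Q)) P := contMDiffAt_pi_space.2 h2
    exact ((PiLp.continuousLinearEquiv 2 ℝ
      (fun _ : Fin n => ℝ)).symm.contDiff.contMDiff.contMDiffAt).comp P h4
  exact h1.prodMk_space h3

/-- The inverse of the induced chart of `T*M`. -/
def cotChartSymm (e : OpenPartialHomeomorph M (E n)) (z : E n × E n) : Cotangent n M :=
  ⟨e.symm z.1, ∑ i, z.2 i • coordForm e i (e.symm z.1)⟩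

theorem cotChart_cotChartSymm (he : e ∈ IsManifold.maximalAtlas 𝓘(ℝ, E n) ∞ M) {z : E n × E n}
    (hz : z.1 ∈ e.target) : cotChart e (cotChartSymm e z : Cotangent n M) = z := by
  refine Prod.ext (e.right_inv hz) (PiLp.ext fun i => ?_)
  change (∑ j, z.2 j • coordForm e j (e.symm z.1)) (coordVec e i (e.symm z.1)) = _
  simp [coordForm_coordVec he (e.map_target hz)]

theorem cotChartSymm_cotChart (he : e ∈ IsManifold.maximalAtlas 𝓘(ℝ, E n) ∞ M)
    {P : Cotangent n M} (hP : P.1 ∈ e.source) : cotChartSymm e (cotChart e P) = P := by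
  obtain ⟨x, α⟩ := P
  -- `e.symm (e x)` is only propositionally equal to `x`, and the fibre depends on it; a free base
  -- point `y` lets the equality be eliminated.
  have key : ∀ y, y = x → (⟨y, ∑ i, α (coordVec e i x) • coordForm e i y⟩ : Cotangent n M)
      = ⟨x, α⟩ := by
    rintro y rfl
    congr 1
    ext u
    conv_rhs => rw [eq_sum_coordVec he hP u, map_sum]
    rw [sum_apply]
    refine Finset.sum_congr rfl fun i _ => ?_
    rw [map_smul, smul_eq_mul, mul_comm]
    rfl
  exact key _ (e.left_inv hP)

theorem contMDiffAt_cotChartSymm (he : e ∈ IsManifold.maximalAtlas 𝓘(ℝ, E n) ∞ M)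
    {z : E n × E n} (hz : z.1 ∈ e.target) :
    ContMDiffAt 𝓘(ℝ, E n × E n) (IT n) ∞ (cotChartSymm (M := M) e) z := by
  have h1 : ContMDiffAt 𝓘(ℝ, E n × E n) 𝓘(ℝ, E n) ∞ (fun z : E n × E n => e.symm z.1) z :=
    (contMDiffAt_symm_of_mem_maximalAtlas he hz).comp z contDiff_fst.contMDiff.contMDiffAt
  rw [contMDiffAt_hom_bundle]
  refine ⟨h1, ?_⟩
  have h2 : ∀ i, _ := fun i => ((contMDiffAt_hom_bundle _).1
    (ContMDiffAt.comp z (contMDiffAt_coordForm (M := M) he (e.map_target hz) i) h1)).2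
  have h3 : ∀ i : Fin n, ContMDiffAt 𝓘(ℝ, E n × E n) 𝓘(ℝ, ℝ) ∞ (fun z : E n × E n => z.2 i) z := by
    intro i
    apply ContDiffAt.contMDiffAt
    fun_prop
  refine (ContMDiffAt.sum (t := Finset.univ) fun i _ => (h3 i).smul (h2 i)).congr_of_eventuallyEq
    (Eventually.of_forall fun y => ?_)
  ext u
  simp [ContinuousLinearMap.inCoordinates, cotChartSymm]

theorem eventually_mem_source {P : Cotangent n M} (hP : P.1 ∈ e.source) :
    ∀ᶠ Q : Cotangent n M in 𝓝 P, Q.1 ∈ e.source :=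
  (FiberBundle.continuous_proj _ _).continuousAt (e.open_source.mem_nhds hP)

/-- Differentiate the two identities between `cotChart` and `cotChartSymm`. Invertibility matters
because `ContinuousLinearMap.inverse`, which defines the coordinate fields on `T*M`, is zero on a
map that is not invertible. -/
theorem isInvertible_dChart (he : e ∈ IsManifold.maximalAtlas 𝓘(ℝ, E n) ∞ M)
    {P : Cotangent n M} (hP : P.1 ∈ e.source) : (dChart e P).IsInvertible := by
  have hz : (cotChart e P).1 ∈ e.target := e.map_source hP
  have h1 := (contMDiffAt_cotChart he hP).mdifferentiableAt (by simp)
  have h2 := (contMDiffAt_cotChartSymm (M := M) he hz).mdifferentiableAt (by simp)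
  have hPP := cotChartSymm_cotChart he hP
  refine ContinuousLinearMap.IsInvertible.of_inverse
    (g := mfderiv 𝓘(ℝ, E n × E n) (IT n) (cotChartSymm (M := M) e) (cotChart e P)) ?_ ?_
  · have h1' : MDifferentiableAt (IT n) 𝓘(ℝ, E n × E n) (cotChart (M := M) e)
      (cotChartSymm e (cotChart e P)) := by rw [hPP]; exact h1
    have := mfderiv_comp (cotChart e P) h1' h2
    rw [hPP] at this
    have h3 : cotChart e ∘ cotChartSymm (M := M) e =ᶠ[𝓝 (cotChart e P)] id := by
      filter_upwards [(e.open_target.preimage continuous_fst).mem_nhds hz] with y hy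
      exact cotChart_cotChartSymm he hy
    exact this.symm.trans ((h3.mfderiv_eq (I := 𝓘(ℝ, E n × E n)) (I' := 𝓘(ℝ, E n × E n))).trans
      (mfderiv_id (I := 𝓘(ℝ, E n × E n)) (x := cotChart e P)))
  · have := mfderiv_comp P h2 h1
    have h3 : cotChartSymm e ∘ cotChart e =ᶠ[𝓝 P] id := by
      filter_upwards [eventually_mem_source hP] with Q hQ
      exact cotChartSymm_cotChart he hQ
    exact this.symm.trans ((h3.mfderiv_eq (I := IT n) (I' := IT n)).trans
      (mfderiv_id (I := IT n) (x := P)))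

theorem contDiffAt_gLow (g : Metric n M) (he : e ∈ IsManifold.maximalAtlas 𝓘(ℝ, E n) ∞ M)
    {q : E n} (hq : q ∈ e.target) (i j : Fin n) : ContDiffAt ℝ ∞ (fun y => gLow g e y i j) q := by
  have hs := contMDiffAt_symm_of_mem_maximalAtlas he hq
  have hv := fun k => (contMDiffAt_coordVec he (e.map_target hq) k).comp q hs
  have hg := g.contMDiff.contMDiffAt.comp q hs
  have := ContMDiffAt.clm_bundle_apply₂ (F₁ := E n) (F₂ := E n) (F₃ := ℝ) (n := ∞)
      (IB := 𝓘(ℝ, E n)) (E₁ := fun x : M => TangentSpace 𝓘(ℝ, E n) x)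
      (E₂ := fun x : M => TangentSpace 𝓘(ℝ, E n) x)
      (E₃ := Bundle.Trivial M ℝ) (b := e.symm) (ψ := fun q => g.inner (e.symm q))
      (v := fun q => coordVec e i (e.symm q)) (w := fun q => coordVec e j (e.symm q))
      (x := q) (IM := 𝓘(ℝ, E n)) hg (hv i) (hv j)
  exact ((Bundle.contMDiffAt_totalSpace.1 this).2).contDiffAt

omit [IsManifold 𝓘(ℝ, E n) ∞ M] in
theorem sum_smul_coordVec_inner {x : M}
    (β : TangentSpace 𝓘(ℝ, E n) x →L[ℝ] TangentSpace 𝓘(ℝ, E n) x →L[ℝ] ℝ)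
    (a b : Fin n → ℝ) :
    β (∑ i, a i • coordVec e i x) (∑ j, b j • coordVec e j x)
      = ∑ i, ∑ j, a i * b j * β (coordVec e i x) (coordVec e j x) := by
  simp only [map_sum, map_smul, sum_apply, smul_apply,
    smul_eq_mul, Finset.mul_sum]
  rw [Finset.sum_comm]
  exact Finset.sum_congr rfl fun i _ => Finset.sum_congr rfl fun j _ => by ring

/-- Supplies both the invertibility of `(g_ij)` and the positivity of the energy off the zero
section. -/
theorem gLow_posDef (g : Metric n M) (he : e ∈ IsManifold.maximalAtlas 𝓘(ℝ, E n) ∞ M) {q : E n}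
    (hq : q ∈ e.target) : (gLow g e q).PosDef := by
  refine Matrix.PosDef.of_dotProduct_mulVec_pos ?_ fun a ha => ?_
  · ext i j
    exact g.symm _ _ _
  · have hx := e.map_target hq
    have hne : ∑ i, a i • coordVec e i (e.symm q) ≠ 0 := by
      intro h
      apply ha
      have h2 := congrArg (mfderiv 𝓘(ℝ, E n) 𝓘(ℝ, E n) e (e.symm q)) h
      simp_rw [map_sum, map_smul, mfderiv_coordVec he hx, map_zero] at h2
      funext j
      have h3 : (EuclideanSpace.proj j : E n →L[ℝ] ℝ) (∑ i, a i • stdVec i) = 0 :=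
        (congrArg (EuclideanSpace.proj j : E n →L[ℝ] ℝ) h2).trans (map_zero _)
      rw [map_sum] at h3
      simpa [stdVec, Pi.single_apply] using h3
    have := g.pos _ _ hne
    rw [sum_smul_coordVec_inner] at this
    refine lt_of_lt_of_eq this ?_
    simp only [dotProduct, Matrix.mulVec, Finset.mul_sum]
    exact Finset.sum_congr rfl fun i _ => Finset.sum_congr rfl fun j _ => by simp [gLow]; ring

end Charts

/-! ### Algebra of the Nijenhuis tensor on a normed space. -/

section VectorSpace

variable {F : Type*} [NormedAddCommGroup F] [NormedSpace ℝ F]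

/-- The Nijenhuis tensor of a field of endomorphisms of a normed space. -/
def flatNijenhuis (J : F → F →L[ℝ] F) (X Y : F → F) (z : F) : F :=
  lieBracket ℝ (fun y => J y (X y)) (fun y => J y (Y y)) z
    - J z (lieBracket ℝ (fun y => J y (X y)) Y z)
    - J z (lieBracket ℝ X (fun y => J y (Y y)) z)
    - lieBracket ℝ X Y z

theorem flatNijenhuis_swap (J : F → F →L[ℝ] F) (X Y : F → F) (z : F) :
    flatNijenhuis J X Y z = -flatNijenhuis J Y X z := by
  simp only [flatNijenhuis]
  rw [lieBracket_swap (V := fun y => J y (X y)) (W := fun y => J y (Y y)),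
    lieBracket_swap (V := fun y => J y (X y)) (W := Y),
    lieBracket_swap (V := X) (W := fun y => J y (Y y)),
    lieBracket_swap (V := X) (W := Y)]
  simp only [map_neg]
  abel

theorem flatNijenhuis_congr_right {J : F → F →L[ℝ] F} {X Y Y' : F → F} {z : F}
    (h : Y =ᶠ[𝓝 z] Y') : flatNijenhuis J X Y z = flatNijenhuis J X Y' z := by
  have h' : (fun y => J y (Y y)) =ᶠ[𝓝 z] fun y => J y (Y' y) := by
    filter_upwards [h] with y hy using by rw [hy]
  simp only [flatNijenhuis]
  rw [EventuallyEq.rfl.lieBracket_vectorField_eq h', EventuallyEq.rfl.lieBracket_vectorField_eq h,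
    EventuallyEq.rfl.lieBracket_vectorField_eq h', EventuallyEq.rfl.lieBracket_vectorField_eq h]

theorem lieBracket_neg_right (X Y : F → F) (z : F) :
    lieBracket ℝ X (fun y => -Y y) z = -lieBracket ℝ X Y z := by
  simp only [lieBracket, fderiv_fun_neg, map_neg, neg_apply]
  abel

/-- `J² = -1` is required on a neighbourhood, since `J(JY)` is differentiated inside the brackets.
-/
theorem flatNijenhuis_apply_right {J : F → F →L[ℝ] F} {X Y : F → F} {z : F}
    (hJ : ∀ᶠ y in 𝓝 z, ∀ u, J y (J y u) = -u) :
    flatNijenhuis J X (fun y => J y (Y y)) z = -J z (flatNijenhuis J X Y z) := by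
  have h : (fun y => J y (J y (Y y))) =ᶠ[𝓝 z] fun y => -Y y := by
    filter_upwards [hJ] with y hy using hy _
  simp only [flatNijenhuis]
  rw [EventuallyEq.rfl.lieBracket_vectorField_eq h, EventuallyEq.rfl.lieBracket_vectorField_eq h,
    lieBracket_neg_right, lieBracket_neg_right]
  simp only [map_sub, map_neg, hJ.self_of_nhds]
  abel

theorem lieBracket_sum_smul_right {ι : Type*} {s : Finset ι} {X : F → F}
    {f : ι → F → ℝ} {Y : ι → F → F} {z : F} (hf : ∀ i ∈ s, DifferentiableAt ℝ (f i) z) (hY : ∀ i ∈ s, DifferentiableAt ℝ (Y i) z) :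
    lieBracket ℝ X (fun y => ∑ i ∈ s, f i y • Y i y) z
      = ∑ i ∈ s, (f i z • lieBracket ℝ X (Y i) z + fderiv ℝ (f i) z (X z) • Y i z) := by
  simp only [lieBracket]
  rw [fderiv_fun_sum (fun i hi => (hf i hi).fun_smul (hY i hi)), sum_apply, map_sum,
    ← Finset.sum_sub_distrib]
  refine Finset.sum_congr rfl fun i hi => ?_
  rw [fderiv_fun_smul (hf i hi) (hY i hi)]
  simp only [add_apply, smul_apply, ContinuousLinearMap.smulRight_apply, map_smul, smul_sub]
  abel

/-- Tensoriality in the second slot. The derivatives of `f` contribute `(JX f)JY - J((JX f)Y)`,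
which vanishes, and `-J((X f)JY) - (X f)Y`, which vanishes because `J² = -1` at `z`. -/
theorem flatNijenhuis_sum_smul_right {ι : Type*} {s : Finset ι} {J : F → F →L[ℝ] F}
    {X : F → F} {f : ι → F → ℝ}
    {Y : ι → F → F} {z : F} (hf : ∀ i ∈ s, DifferentiableAt ℝ (f i) z)
    (hY : ∀ i ∈ s, DifferentiableAt ℝ (Y i) z)
    (hJY : ∀ i ∈ s, DifferentiableAt ℝ (fun y => J y (Y i y)) z)
    (hJ : ∀ u, J z (J z u) = -u) :
    flatNijenhuis J X (fun y => ∑ i ∈ s, f i y • Y i y) z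
      = ∑ i ∈ s, f i z • flatNijenhuis J X (Y i) z := by
  simp only [flatNijenhuis, map_sum, map_smul]
  rw [lieBracket_sum_smul_right hf hY, lieBracket_sum_smul_right hf hY,
    lieBracket_sum_smul_right hf hJY, lieBracket_sum_smul_right hf hJY]
  simp only [map_sum, ← Finset.sum_sub_distrib]
  refine Finset.sum_congr rfl fun i _ => ?_
  simp only [map_add, map_smul, hJ, smul_sub, smul_neg]
  abel

end VectorSpace

/-! ### Metric, connection and almost complex structure in coordinates. -/

section Coordinates

variable {n : ℕ}

/-- `Γ` are the Christoffel symbols, on the open set `U`, of the metric with matrix `a` whose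
inverse matrix is `b`. -/
structure IsLeviCivita (U : Set (E n)) (a b : E n → Matrix (Fin n) (Fin n) ℝ)
    (Γ : Fin n → Fin n → Fin n → E n → ℝ) : Prop where
  isOpen : IsOpen U
  symm : ∀ q ∈ U, ∀ i j, a q i j = a q j i
  mul_inv : ∀ q ∈ U, a q * b q = 1
  differentiableAt : ∀ q ∈ U, ∀ i j, DifferentiableAt ℝ (fun y => a y i j) q
  differentiableAt_inv : ∀ q ∈ U, ∀ i j, DifferentiableAt ℝ (fun y => b y i j) q
  differentiableAt_symbol : ∀ q ∈ U, ∀ k i j, DifferentiableAt ℝ (Γ k i j) q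
  torsion_free : ∀ q ∈ U, ∀ k i j, Γ k i j q = Γ k j i q
  compat : ∀ q ∈ U, ∀ k i j, pderiv k (fun y => a y i j) q
    = ∑ l, (Γ l k i q * a q l j + Γ l k j q * a q i l)

/-- `Γ^0_ih = p_k Γ^k_ih` in coordinates. -/
def flatChristoffelZero (Γ : Fin n → Fin n → Fin n → E n → ℝ) (i h : Fin n) (z : E n × E n) : ℝ :=
  ∑ k, z.2 k * Γ k i h z.1

/-- The field `δ/δqⁱ` in coordinates. -/
def flatHor (Γ : Fin n → Fin n → Fin n → E n → ℝ) (i : Fin n) (z : E n × E n) : E n × E n :=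
  (stdVec i, WithLp.toLp 2 fun h => flatChristoffelZero Γ i h z)

/-- The vertical vector with fibre components `x`. -/
def flatVer (x : Fin n → ℝ) : E n × E n := (0, WithLp.toLp 2 x)

/-- The energy density `t` in coordinates. -/
def flatEnergy (b : E n → Matrix (Fin n) (Fin n) ℝ) (z : E n × E n) : ℝ :=
  (1 / 2) * ∑ i, ∑ k, b z.1 i k * z.2 i * z.2 k

/-- `g^0i` in coordinates. -/
def flatZero (b : E n → Matrix (Fin n) (Fin n) ℝ) (i : Fin n) (z : E n × E n) : ℝ :=
  ∑ h, z.2 h * b z.1 h i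

/-- `G_ij` in coordinates. -/
def flatG (a b : E n → Matrix (Fin n) (Fin n) ℝ) (A : ℝ) (v : ℝ → ℝ) (i j : Fin n)
    (z : E n × E n) : ℝ :=
  A * flatEnergy b z * a z.1 i j + v (flatEnergy b z) * z.2 i * z.2 j

/-- `H^kl` in coordinates. -/
def flatH (b : E n → Matrix (Fin n) (Fin n) ℝ) (A : ℝ) (v : ℝ → ℝ) (k l : Fin n)
    (z : E n × E n) : ℝ :=
  1 / (A * flatEnergy b z) * b z.1 k l
    + wFun A v (flatEnergy b z) * flatZero b k z * flatZero b l z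

/-- The 1-form `Dp_i` in coordinates. -/
def flatDp (Γ : Fin n → Fin n → Fin n → E n → ℝ) (i : Fin n) (z : E n × E n) :
    E n × E n →L[ℝ] ℝ :=
  (EuclideanSpace.proj i).comp (ContinuousLinearMap.snd ℝ (E n) (E n))
    - ∑ j, flatChristoffelZero Γ i j z •
      (EuclideanSpace.proj j).comp (ContinuousLinearMap.fst ℝ (E n) (E n))

/-- The almost complex structure in coordinates. -/
def flatJ (a b : E n → Matrix (Fin n) (Fin n) ℝ) (Γ : Fin n → Fin n → Fin n → E n → ℝ) (A : ℝ)
    (v : ℝ → ℝ) (z : E n × E n) : E n × E n →L[ℝ] E n × E n :=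
  (∑ i, ((EuclideanSpace.proj i).comp (ContinuousLinearMap.fst ℝ (E n) (E n))).smulRight
      (flatVer fun k => flatG a b A v i k z))
    - ∑ i, (flatDp Γ i z).smulRight (∑ k, flatH b A v i k z • flatHor Γ k z)

/-- The components of the curvature tensor of the connection `Γ`. -/
def flatCurvature (Γ : Fin n → Fin n → Fin n → E n → ℝ) (h k i j : Fin n) (q : E n) : ℝ :=
  pderiv i (Γ h j k) q - pderiv j (Γ h i k) q + ∑ l, (Γ h i l q * Γ l j k q - Γ h j l q * Γ l i k q)

/-- The contraction occurring in the Nijenhuis tensor, in coordinates. -/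
def flatT (a b : E n → Matrix (Fin n) (Fin n) ℝ) (Γ : Fin n → Fin n → Fin n → E n → ℝ) (A : ℝ)
    (v : ℝ → ℝ) (k i j : Fin n) (z : E n × E n) : ℝ :=
  ∑ h, (A * flatEnergy b z * (v (flatEnergy b z) + A)
      * (kron h i * a z.1 j k - kron h j * a z.1 i k)
    - flatCurvature Γ h k i j z.1) * z.2 h

theorem flatVer_eq_sum (x : Fin n → ℝ) : flatVer x = ∑ k, x k • ((0, stdVec k) : E n × E n) := by
  refine Prod.ext ?_ (PiLp.ext fun j => ?_)
  · simp [flatVer, Prod.fst_sum]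
  · simp [flatVer, Prod.snd_sum, stdVec, Pi.single_apply]

section

variable {U : Set (E n)} {a b : E n → Matrix (Fin n) (Fin n) ℝ}
  {Γ : Fin n → Fin n → Fin n → E n → ℝ} (h : IsLeviCivita U a b Γ) {A : ℝ} {v : ℝ → ℝ}
  {z : E n × E n}

include h

theorem IsLeviCivita.inv_mul {q : E n} (hq : q ∈ U) : b q * a q = 1 :=
  mul_eq_one_comm.1 (h.mul_inv q hq)

theorem IsLeviCivita.transpose_eq {q : E n} (hq : q ∈ U) : (a q).transpose = a q :=
  Matrix.ext fun i j => h.symm q hq j i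

theorem IsLeviCivita.transpose_inv {q : E n} (hq : q ∈ U) : (b q).transpose = b q := by
  have h1 : (b q).transpose * a q = 1 := by
    rw [← h.transpose_eq hq, ← Matrix.transpose_mul, h.mul_inv q hq, Matrix.transpose_one]
  calc (b q).transpose = (b q).transpose * (a q * b q) := by rw [h.mul_inv q hq, mul_one]
    _ = b q := by rw [← mul_assoc, h1, one_mul]

theorem IsLeviCivita.inv_symm {q : E n} (hq : q ∈ U) (i j : Fin n) : b q i j = b q j i :=
  congrFun (congrFun (h.transpose_inv hq) j) i

/-- Differentiating `a b = 1` gives `∂b = -b(∂a)b`, and compatibility reads `∂a = Cᵀa + aC` in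
matrix form, with `C` the matrix of symbols; hence `∂b = -(Cb + bCᵀ)`. -/
theorem IsLeviCivita.pderiv_inv {q : E n} (hq : q ∈ U) (k i j : Fin n) :
    pderiv k (fun y => b y i j) q = -∑ l, (Γ i k l q * b q l j + Γ j k l q * b q i l) := by
  set D : Matrix (Fin n) (Fin n) ℝ := Matrix.of fun i j => pderiv k (fun y => a y i j) q with hD
  set D' : Matrix (Fin n) (Fin n) ℝ := Matrix.of fun i j => pderiv k (fun y => b y i j) q with hD'
  set C : Matrix (Fin n) (Fin n) ℝ := Matrix.of fun l j => Γ l k j q with hC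
  have h1 : D = C.transpose * a q + a q * C := by
    ext i j
    simp only [hD, Matrix.of_apply, h.compat q hq, Matrix.add_apply, Matrix.mul_apply,
      ← Finset.sum_add_distrib, hC, Matrix.transpose_apply]
    exact Finset.sum_congr rfl fun l _ => by ring
  have h2 : D * b q + a q * D' = 0 := by
    ext i j
    have h3 : fderiv ℝ (fun y => ∑ m, a y i m * b y m j) q = 0 := by
      have : (fun y => ∑ m, a y i m * b y m j) =ᶠ[𝓝 q]
          fun _ => (1 : Matrix (Fin n) (Fin n) ℝ) i j := by
        filter_upwards [h.isOpen.mem_nhds hq] with y hy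
        rw [← h.mul_inv y hy, Matrix.mul_apply]
      rw [this.fderiv_eq, fderiv_fun_const, Pi.zero_apply]
    rw [fderiv_fun_sum fun m _ =>
      (h.differentiableAt q hq i m).fun_mul (h.differentiableAt_inv q hq m j)] at h3
    have h4 := congrArg (fun f => f (stdVec k)) h3
    simp only [sum_apply, zero_apply] at h4
    simp only [Matrix.add_apply, Matrix.mul_apply, ← Finset.sum_add_distrib, Matrix.zero_apply]
    rw [← h4]
    refine Finset.sum_congr rfl fun m _ => ?_
    rw [fderiv_fun_mul (h.differentiableAt q hq i m) (h.differentiableAt_inv q hq m j)]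
    simp only [hD, hD', Matrix.of_apply, pderiv, add_apply, smul_apply, smul_eq_mul]
    ring
  have h3 : D' = -(C * b q + b q * C.transpose) := by
    have h4 : D' = b q * (a q * D') := by rw [← mul_assoc, h.inv_mul hq, one_mul]
    rw [h4, eq_neg_of_add_eq_zero_right h2, h1]
    have h5 : b q * -((C.transpose * a q + a q * C) * b q)
      = -(b q * C.transpose * (a q * b q) + (b q * a q) * C * b q) := by noncomm_ring
    rw [h5, h.mul_inv q hq, h.inv_mul hq]
    noncomm_ring
  have h4 := congrFun (congrFun h3 i) j
  simp only [hD', Matrix.of_apply] at h4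
  rw [h4]
  simp only [Matrix.neg_apply, Matrix.add_apply, Matrix.mul_apply, ← Finset.sum_add_distrib, hC,
    Matrix.transpose_apply, Matrix.of_apply]
  exact congrArg _ (Finset.sum_congr rfl fun l _ => by ring)

theorem flatDp_flatHor (hz : z.1 ∈ U) (i j : Fin n) : flatDp Γ i z (flatHor Γ j z) = 0 := by
  simp [flatDp, flatHor, stdVec, flatChristoffelZero, h.torsion_free z.1 hz _ i j]

omit h in
theorem flatDp_flatVer (i : Fin n) (x : Fin n → ℝ) : flatDp Γ i z (flatVer x) = x i := by
  simp [flatDp, flatVer]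

theorem flatJ_flatHor (hz : z.1 ∈ U) (i : Fin n) :
    flatJ a b Γ A v z (flatHor Γ i z) = flatVer fun k => flatG a b A v i k z := by
  simp only [flatJ, sub_apply, sum_apply, ContinuousLinearMap.smulRight_apply,
    flatDp_flatHor h hz]
  simp [flatHor, stdVec, ite_smul]

omit h in
theorem flatJ_flatVer (x : Fin n → ℝ) :
    flatJ a b Γ A v z (flatVer x) = -∑ i, x i • ∑ k, flatH b A v i k z • flatHor Γ k z := by
  simp only [flatJ, sub_apply, sum_apply, ContinuousLinearMap.smulRight_apply, flatDp_flatVer]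
  simp [flatVer]

end

end Coordinates

/-! ### Derivatives along the adapted frame and the horizontal-horizontal component. -/

section Coordinates

variable {n : ℕ}

theorem hasFDerivAt_snd_apply (i : Fin n) (z : E n × E n) :
    HasFDerivAt (fun y : E n × E n => y.2 i)
      ((EuclideanSpace.proj i).comp (ContinuousLinearMap.snd ℝ (E n) (E n))) z :=
  ((EuclideanSpace.proj i : E n →L[ℝ] ℝ).comp
    (ContinuousLinearMap.snd ℝ (E n) (E n))).hasFDerivAt

theorem hasFDerivAt_comp_fst {f : E n → ℝ} {z : E n × E n} (hf : DifferentiableAt ℝ f z.1) :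
    HasFDerivAt (fun y : E n × E n => f y.1)
      ((fderiv ℝ f z.1).comp (ContinuousLinearMap.fst ℝ (E n) (E n))) z :=
  hf.hasFDerivAt.comp z hasFDerivAt_fst

/-- The fields `δ_i` and `Jδ_i` all have a constant base component, so every bracket of the first
formula is vertical and only fibre components need differentiating. -/
theorem lieBracket_of_snd {c d : E n} {x y : Fin n → E n × E n → ℝ} {z : E n × E n}
    (hx : ∀ i, DifferentiableAt ℝ (x i) z) (hy : ∀ i, DifferentiableAt ℝ (y i) z) :
    lieBracket ℝ (fun w => (c, WithLp.toLp 2 fun i => x i w))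
        (fun w => (d, WithLp.toLp 2 fun i => y i w)) z
      = flatVer fun i => fderiv ℝ (y i) z (c, WithLp.toLp 2 fun i => x i z)
          - fderiv ℝ (x i) z (d, WithLp.toLp 2 fun i => y i z) := by
  have key : ∀ (d : E n) (y : Fin n → E n × E n → ℝ), (∀ i, DifferentiableAt ℝ (y i) z) →
      ∀ w, fderiv ℝ (fun w => ((d, WithLp.toLp 2 fun i => y i w) : E n × E n)) z w
        = flatVer fun i => fderiv ℝ (y i) z w := by
    intro d y hy w
    have h1 : HasFDerivAt (fun w => fun i => y i w)
      (ContinuousLinearMap.pi fun i => fderiv ℝ (y i) z) z :=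
      hasFDerivAt_pi.2 fun i => (hy i).hasFDerivAt
    have h2 := ((PiLp.continuousLinearEquiv 2 ℝ (fun _ : Fin n => ℝ)).symm.hasFDerivAt).comp z h1
    have h3 := (hasFDerivAt_const d z).prodMk h2
    exact congrArg (fun f => f w) h3.fderiv
  rw [lieBracket, key d y hy, key c x hx]
  refine Prod.ext ?_ (PiLp.ext fun j => ?_)
  · simp [flatVer]
  · simp [flatVer]

variable {U : Set (E n)} {a b : E n → Matrix (Fin n) (Fin n) ℝ}
  {Γ : Fin n → Fin n → Fin n → E n → ℝ} (h : IsLeviCivita U a b Γ) {A : ℝ} {v : ℝ → ℝ}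
  {z : E n × E n}

include h

theorem differentiableAt_flatChristoffelZero (hz : z.1 ∈ U) (i k : Fin n) :
    DifferentiableAt ℝ (flatChristoffelZero Γ i k) z :=
  DifferentiableAt.fun_sum fun j _ => (hasFDerivAt_snd_apply j z).differentiableAt.fun_mul
    (hasFDerivAt_comp_fst (h.differentiableAt_symbol z.1 hz j i k)).differentiableAt

theorem fderiv_flatChristoffelZero (hz : z.1 ∈ U) (i k : Fin n) (w : E n × E n) :
    fderiv ℝ (flatChristoffelZero Γ i k) z w
      = ∑ j, (w.2 j * Γ j i k z.1 + z.2 j * fderiv ℝ (Γ j i k) z.1 w.1) := by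
  have := HasFDerivAt.fun_sum (u := Finset.univ) fun j _ => (hasFDerivAt_snd_apply j z).fun_mul
    (hasFDerivAt_comp_fst (h.differentiableAt_symbol z.1 hz j i k))
  refine (congrArg (fun f => f w) this.fderiv).trans ?_
  simp only [sum_apply]
  refine Finset.sum_congr rfl fun j _ => ?_
  simp
  ring

theorem differentiableAt_flatEnergy (hz : z.1 ∈ U) :
    DifferentiableAt ℝ (flatEnergy b) z :=
  (DifferentiableAt.fun_sum fun i _ => DifferentiableAt.fun_sum fun k _ =>
    ((hasFDerivAt_comp_fst (h.differentiableAt_inv z.1 hz i k)).differentiableAt.fun_mul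
    (hasFDerivAt_snd_apply i z).differentiableAt).fun_mul
    (hasFDerivAt_snd_apply k z).differentiableAt).const_mul _

theorem fderiv_flatEnergy (hz : z.1 ∈ U) (w : E n × E n) :
    fderiv ℝ (flatEnergy b) z w = (∑ k, flatZero b k z * w.2 k)
      + (1 / 2) * ∑ i, ∑ k, fderiv ℝ (fun y => b y i k) z.1 w.1 * z.2 i * z.2 k := by
  have := (HasFDerivAt.fun_sum (u := Finset.univ) fun i _ =>
    HasFDerivAt.fun_sum (u := Finset.univ) fun k _ =>
    ((hasFDerivAt_comp_fst (h.differentiableAt_inv z.1 hz i k)).fun_mul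
    (hasFDerivAt_snd_apply i z)).fun_mul
    (hasFDerivAt_snd_apply k z)).const_mul (1 / 2 : ℝ)
  refine (congrArg (fun f => f w) this.fderiv).trans ?_
  have e1 : ∑ k, flatZero b k z * w.2 k = ∑ i, ∑ k, b z.1 i k * z.2 i * w.2 k := by
    simp only [flatZero, Finset.sum_mul]
    rw [Finset.sum_comm]
    exact Finset.sum_congr rfl fun i _ => Finset.sum_congr rfl fun k _ => by ring
  have e2 : ∑ k, flatZero b k z * w.2 k = ∑ i, ∑ k, b z.1 i k * w.2 i * z.2 k := by
    simp only [flatZero, Finset.sum_mul]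
    exact Finset.sum_congr rfl fun i _ => Finset.sum_congr rfl fun k _ => by
      rw [h.inv_symm hz]; ring
  have e3 : ∑ k, flatZero b k z * w.2 k
      = (1 / 2) * (∑ i, ∑ k, b z.1 i k * z.2 i * w.2 k + ∑ i, ∑ k, b z.1 i k * w.2 i * z.2 k) := by
    rw [← e1, ← e2]; ring
  rw [e3, ← mul_add, ← Finset.sum_add_distrib, ← Finset.sum_add_distrib]
  simp only [smul_apply, sum_apply, smul_eq_mul]
  congr 1
  refine Finset.sum_congr rfl fun i _ => ?_
  rw [← Finset.sum_add_distrib, ← Finset.sum_add_distrib]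
  refine Finset.sum_congr rfl fun k _ => ?_
  simp
  ring

/-- Parallel transport preserves the norm of a covector. In coordinates, the two terms of `∂_i g^jk`
contribute equally and cancel the derivative in the fibre direction `p_k Γ^k_ih`. -/
theorem fderiv_flatEnergy_flatHor (hz : z.1 ∈ U) (i : Fin n) :
    fderiv ℝ (flatEnergy b) z (flatHor Γ i z) = 0 := by
  rw [fderiv_flatEnergy h hz]
  have e0 : ∀ j k, fderiv ℝ (fun y => b y j k) z.1 (flatHor Γ i z).1
      = -∑ l, (Γ j i l z.1 * b z.1 l k + Γ k i l z.1 * b z.1 j l) := fun j k =>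
    h.pderiv_inv hz i j k
  have e1 : ∑ j, ∑ k, (∑ l, Γ j i l z.1 * b z.1 l k) * z.2 j * z.2 k
      = ∑ l, flatZero b l z * flatChristoffelZero Γ i l z := by
    simp only [flatZero, flatChristoffelZero, Finset.sum_mul]
    have : ∀ j, ∑ k, ∑ l, Γ j i l z.1 * b z.1 l k * z.2 j * z.2 k
      = ∑ l, ∑ k, Γ j i l z.1 * b z.1 l k * z.2 j * z.2 k := fun j => Finset.sum_comm
    simp only [this]
    rw [Finset.sum_comm]
    refine Finset.sum_congr rfl fun l _ => ?_
    rw [Finset.sum_comm]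
    refine Finset.sum_congr rfl fun k _ => ?_
    rw [Finset.mul_sum]
    exact Finset.sum_congr rfl fun j _ => by rw [h.inv_symm hz k l]; ring
  -- This is `e1` with `j` and `k` exchanged.
  have e2 : ∑ j, ∑ k, (∑ l, Γ k i l z.1 * b z.1 j l) * z.2 j * z.2 k
      = ∑ l, flatZero b l z * flatChristoffelZero Γ i l z := by
    rw [← e1, Finset.sum_comm]
    refine Finset.sum_congr rfl fun k _ => Finset.sum_congr rfl fun j _ => ?_
    rw [mul_right_comm]
    simp only [h.inv_symm hz j]
  simp only [e0]
  simp only [Finset.sum_add_distrib, neg_mul, add_mul, Finset.sum_neg_distrib, neg_add, e1, e2]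
  simp only [flatHor]
  ring

theorem differentiableAt_flatG (hz : z.1 ∈ U) (hv : DifferentiableAt ℝ v (flatEnergy b z))
    (i j : Fin n) : DifferentiableAt ℝ (flatG a b A v i j) z :=
  (((differentiableAt_flatEnergy h hz).const_mul A).fun_mul
    (hasFDerivAt_comp_fst (h.differentiableAt z.1 hz i j)).differentiableAt).fun_add
    (((hv.comp z (differentiableAt_flatEnergy h hz)).fun_mul
      (hasFDerivAt_snd_apply i z).differentiableAt).fun_mul
      (hasFDerivAt_snd_apply j z).differentiableAt)

theorem fderiv_flatG (hz : z.1 ∈ U) (hv : DifferentiableAt ℝ v (flatEnergy b z))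
    (i j : Fin n) (w : E n × E n) :
    fderiv ℝ (flatG a b A v i j) z w
      = A * fderiv ℝ (flatEnergy b) z w * a z.1 i j
        + A * flatEnergy b z * fderiv ℝ (fun y => a y i j) z.1 w.1
        + deriv v (flatEnergy b z) * fderiv ℝ (flatEnergy b) z w * z.2 i * z.2 j
        + v (flatEnergy b z) * (w.2 i * z.2 j + z.2 i * w.2 j) := by
  have := (((differentiableAt_flatEnergy h hz).hasFDerivAt.const_mul A).fun_mul
    (hasFDerivAt_comp_fst (h.differentiableAt z.1 hz i j))).fun_add
    (((hv.hasDerivAt.comp_hasFDerivAt z (differentiableAt_flatEnergy h hz).hasFDerivAt).fun_mul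
      (hasFDerivAt_snd_apply i z)).fun_mul (hasFDerivAt_snd_apply j z))
  refine (congrArg (fun f => f w) this.fderiv).trans ?_
  simp
  ring

/-- `G` is parallel: it is built from `g`, `p` and functions of `t`, all covariantly constant along
horizontal directions. In particular `v'` drops out. -/
theorem fderiv_flatG_flatHor (hz : z.1 ∈ U) (hv : DifferentiableAt ℝ v (flatEnergy b z))
    (i j k : Fin n) :
    fderiv ℝ (flatG a b A v j k) z (flatHor Γ i z)
      = ∑ l, (Γ l i j z.1 * flatG a b A v l k z + Γ l i k z.1 * flatG a b A v j l z) := by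
  rw [fderiv_flatG h hz hv, fderiv_flatEnergy_flatHor h hz]
  have e0 : fderiv ℝ (fun y => a y j k) z.1 (flatHor Γ i z).1 = _ := h.compat z.1 hz i j k
  rw [e0]
  simp only [flatHor, flatChristoffelZero, flatG, mul_zero, zero_mul, zero_add, add_zero,
    Finset.mul_sum, Finset.sum_mul, ← Finset.sum_add_distrib]
  exact Finset.sum_congr rfl fun l _ => by ring

/-- Raising the index of `p` and applying `G` returns a multiple of `p`, because `g^0k g_ik = p_i`
and `g^0k p_k = 2t`. This is the origin of the factor `A + 2v`. -/
theorem sum_flatZero_mul_flatG (hz : z.1 ∈ U) (i : Fin n) :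
    ∑ k, flatZero b k z * flatG a b A v i k z
      = flatEnergy b z * (A + 2 * v (flatEnergy b z)) * z.2 i := by
  have e1 : ∑ k, flatZero b k z * a z.1 i k = z.2 i := by
    have := congrFun (congrArg (fun m => Matrix.vecMul (fun j => z.2 j) m) (h.inv_mul hz)) i
    simp only [← Matrix.vecMul_vecMul, Matrix.vecMul_one] at this
    rw [← this]
    simp only [Matrix.vecMul, dotProduct, flatZero]
    exact Finset.sum_congr rfl fun k _ => by rw [h.symm _ hz]
  have e2 : ∑ k, flatZero b k z * z.2 k = 2 * flatEnergy b z := by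
    simp only [flatZero, flatEnergy, Finset.sum_mul]
    rw [Finset.sum_comm, ← mul_assoc]
    norm_num
    exact Finset.sum_congr rfl fun k _ => Finset.sum_congr rfl fun j _ => by ring
  calc _ = A * flatEnergy b z * (∑ k, flatZero b k z * a z.1 i k)
        + v (flatEnergy b z) * z.2 i * ∑ k, flatZero b k z * z.2 k := by
        simp only [flatG, Finset.mul_sum, ← Finset.sum_add_distrib]
        exact Finset.sum_congr rfl fun l _ => by ring
    _ = _ := by rw [e1, e2]; ring

theorem fderiv_flatEnergy_flatVer (hz : z.1 ∈ U) (x : Fin n → ℝ) :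
    fderiv ℝ (flatEnergy b) z (flatVer x) = ∑ k, flatZero b k z * x k := by
  rw [fderiv_flatEnergy h hz]
  simp [flatVer]

/-- The four brackets are `b4`, `b1`, `b2`, `b3` in the order of the definition of `N`.
Invertibility of `G` plays no role here: `J` acts only on horizontal fields until the two remaining
`J`-terms cancel. -/
theorem flatNijenhuis_flatHor_flatHor (hz : z.1 ∈ U)
    (hv : DifferentiableAt ℝ v (flatEnergy b z)) (i j : Fin n) :
    flatNijenhuis (flatJ a b Γ A v) (flatHor Γ i) (flatHor Γ j) z
      = flatVer fun k => flatT a b Γ A v k i j z := by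
  have hJ : ∀ i, (fun y => flatJ a b Γ A v y (flatHor Γ i y)) =ᶠ[𝓝 z]
      fun y => (0, WithLp.toLp 2 fun k => flatG a b A v i k y) := by
    intro i
    filter_upwards [(h.isOpen.preimage continuous_fst).mem_nhds hz] with y hy
    exact flatJ_flatHor h hy i
  have hG := fun i k => differentiableAt_flatG (A := A) h hz hv i k
  have hΓ := fun i k => differentiableAt_flatChristoffelZero h hz i k
  have b1 : lieBracket ℝ (fun y => flatJ a b Γ A v y (flatHor Γ i y)) (flatHor Γ j) z
      = flatVer fun k => -∑ l, Γ l i j z.1 * flatG a b A v l k z := by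
    rw [(hJ i).lieBracket_vectorField_eq EventuallyEq.rfl]
    refine (lieBracket_of_snd (hG i) (hΓ j)).trans (congrArg _ (funext fun k => ?_))
    have := fderiv_flatG_flatHor (A := A) h hz hv j i k
    rw [flatHor] at this
    rw [this, fderiv_flatChristoffelZero h hz]
    simp only [map_zero, mul_zero, add_zero, ← Finset.sum_sub_distrib, ← Finset.sum_neg_distrib]
    refine Finset.sum_congr rfl fun l _ => ?_
    rw [h.torsion_free _ hz l j i]
    ring
  have b2 : lieBracket ℝ (flatHor Γ i) (fun y => flatJ a b Γ A v y (flatHor Γ j y)) z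
      = flatVer fun k => ∑ l, Γ l i j z.1 * flatG a b A v l k z := by
    rw [EventuallyEq.rfl.lieBracket_vectorField_eq (hJ j)]
    refine (lieBracket_of_snd (hΓ i) (hG j)).trans (congrArg _ (funext fun k => ?_))
    have := fderiv_flatG_flatHor (A := A) h hz hv i j k
    rw [flatHor] at this
    rw [this, fderiv_flatChristoffelZero h hz]
    simp only [map_zero, mul_zero, add_zero, ← Finset.sum_sub_distrib]
    refine Finset.sum_congr rfl fun l _ => ?_
    ring
  have b3 : lieBracket ℝ (flatHor Γ i) (flatHor Γ j) z
      = flatVer fun k => ∑ l, flatCurvature Γ l k i j z.1 * z.2 l := by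
    refine (lieBracket_of_snd (hΓ i) (hΓ j)).trans (congrArg _ (funext fun k => ?_))
    rw [fderiv_flatChristoffelZero h hz, fderiv_flatChristoffelZero h hz]
    -- The fibre derivative of `Γ^0_jk` along `Γ^0_i` produces the quadratic terms of the curvature.
    have e1 : ∀ i j, ∑ l, flatChristoffelZero Γ i l z * Γ l j k z.1
        = ∑ m, z.2 m * ∑ l, Γ m i l z.1 * Γ l j k z.1 := by
      intro i j
      simp only [flatChristoffelZero, Finset.sum_mul, Finset.mul_sum]
      rw [Finset.sum_comm]
      exact Finset.sum_congr rfl fun m _ => Finset.sum_congr rfl fun l _ => by ring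
    simp only [Finset.sum_add_distrib]
    rw [e1 i j, e1 j i]
    simp only [← Finset.sum_add_distrib, ← Finset.sum_sub_distrib]
    refine Finset.sum_congr rfl fun m _ => ?_
    simp only [flatCurvature, pderiv, Finset.sum_sub_distrib]
    ring
  have b4 : lieBracket ℝ (fun y => flatJ a b Γ A v y (flatHor Γ i y))
      (fun y => flatJ a b Γ A v y (flatHor Γ j y)) z
      = flatVer fun k => A * flatEnergy b z * (v (flatEnergy b z) + A)
        * (z.2 i * a z.1 j k - z.2 j * a z.1 i k) := by
    rw [(hJ i).lieBracket_vectorField_eq (hJ j)]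
    refine (lieBracket_of_snd (hG i) (hG j)).trans (congrArg _ (funext fun k => ?_))
    have e1 := fun i => fderiv_flatEnergy_flatVer h hz fun k => flatG a b A v i k z
    simp only [flatVer] at e1
    -- After antisymmetrisation in `i`, `j` the `v'` terms cancel; `At(A + 2v)` from `dt` combines
    -- with `-Atv` from differentiating `p_i p_k` to give `At(A + v)`.
    rw [fderiv_flatG h hz hv, fderiv_flatG h hz hv, e1, e1, sum_flatZero_mul_flatG h hz,
      sum_flatZero_mul_flatG h hz]
    simp only [flatG, map_zero]
    rw [h.symm _ hz j i]
    ring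
  rw [flatNijenhuis, b4, b1, b2, b3]
  -- By `b1` and `b2` the mixed brackets are `-x` and `x`, so their `J`-images cancel unevaluated.
  have e5 : ∀ (w : E n × E n) (x : Fin n → ℝ), w - flatJ a b Γ A v z (flatVer fun k => -x k)
      - flatJ a b Γ A v z (flatVer x) = w := by
    intro w x
    have : flatVer (fun k => -x k) = -flatVer x := by
      refine Prod.ext ?_ (PiLp.ext fun j => ?_) <;> simp [flatVer]
    rw [this, map_neg]
    abel
  rw [e5]
  refine Prod.ext ?_ (PiLp.ext fun k => ?_)
  · simp [flatVer]
  · simp [flatVer, flatT, sub_mul, Finset.sum_sub_distrib, kron, mul_sub]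
    ring

end Coordinates

/-! ### Inverse matrix, `J² = -1`, and the components with vertical arguments. -/

section Coordinates

variable {n : ℕ}

theorem flatVer_sum_smul {ι : Type*} (s : Finset ι) (c : ι → ℝ) (x : ι → Fin n → ℝ) :
    ∑ i ∈ s, c i • flatVer (x i) = flatVer fun k => ∑ i ∈ s, c i * x i k := by
  refine Prod.ext ?_ (PiLp.ext fun j => ?_)
  · simp [flatVer, Prod.fst_sum]
  · simp [flatVer, Prod.snd_sum]

theorem flatVer_single (j : Fin n) :
    flatVer (fun k => (1 : Matrix (Fin n) (Fin n) ℝ) j k) = ((0, stdVec j) : E n × E n) := by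
  refine Prod.ext ?_ (PiLp.ext fun k => ?_)
  · simp [flatVer]
  · simp [flatVer, stdVec, Matrix.one_apply, eq_comm]

theorem eq_sum_flatHor_add_flatVer (Γ : Fin n → Fin n → Fin n → E n → ℝ) (z u : E n × E n)
    (hΓ : ∀ i j, flatChristoffelZero Γ i j z = flatChristoffelZero Γ j i z) :
    u = ∑ i, u.1 i • flatHor Γ i z + flatVer fun k => flatDp Γ k z u := by
  refine Prod.ext (PiLp.ext fun j => ?_) (PiLp.ext fun j => ?_)
  · simp [flatHor, flatVer, Prod.fst_sum, stdVec, Pi.single_apply]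
  · simp [flatHor, flatVer, flatDp, Prod.snd_sum, hΓ j]
    rw [Finset.sum_congr rfl fun i _ => mul_comm (u.1 i) _]
    ring

variable {U : Set (E n)} {a b : E n → Matrix (Fin n) (Fin n) ℝ}
  {Γ : Fin n → Fin n → Fin n → E n → ℝ} (h : IsLeviCivita U a b Γ) {A : ℝ} {v : ℝ → ℝ}
  {z : E n × E n}

include h

theorem flatH_symm (hz : z.1 ∈ U) (i j : Fin n) : flatH b A v i j z = flatH b A v j i z := by
  rw [flatH, flatH, h.inv_symm hz]
  ring

/-- Sherman–Morrison: `G` is a rank-one perturbation of `At g`, and `w` is the coefficient for which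
the terms in `p_i g^0j` cancel. -/
theorem flatG_mul_flatH (hz : z.1 ∈ U) (hA : A ≠ 0) (ht : flatEnergy b z ≠ 0)
    (hAv : A + 2 * v (flatEnergy b z) ≠ 0) :
    (Matrix.of fun i j => flatG a b A v i j z) * (Matrix.of fun i j => flatH b A v i j z) = 1 := by
  ext i j
  simp only [Matrix.mul_apply, Matrix.of_apply]
  have e1 := sum_flatZero_mul_flatG h (A := A) (v := v) hz i
  have e2 : ∑ k, a z.1 i k * b z.1 k j = (1 : Matrix (Fin n) (Fin n) ℝ) i j := by
    rw [← h.mul_inv _ hz, Matrix.mul_apply]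
  have e3 : ∑ k, flatG a b A v i k z * b z.1 k j = A * flatEnergy b z *
      (1 : Matrix (Fin n) (Fin n) ℝ) i j + v (flatEnergy b z) * z.2 i * flatZero b j z := by
    rw [← e2]
    simp only [flatG, flatZero, Finset.mul_sum, ← Finset.sum_add_distrib]
    exact Finset.sum_congr rfl fun k _ => by ring
  calc ∑ k, flatG a b A v i k z * flatH b A v k j z
      = 1 / (A * flatEnergy b z) * (∑ k, flatG a b A v i k z * b z.1 k j)
        + wFun A v (flatEnergy b z) * flatZero b j z *
          ∑ k, flatZero b k z * flatG a b A v i k z := by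
        simp only [flatH, Finset.mul_sum, ← Finset.sum_add_distrib]
        exact Finset.sum_congr rfl fun k _ => by ring
    _ = _ := by
        have e4 : wFun A v (flatEnergy b z) * (A + 2 * v (flatEnergy b z))
            = -v (flatEnergy b z) / (A * flatEnergy b z ^ 2) := by
          rw [wFun, div_mul_eq_mul_div, mul_div_mul_right _ _ hAv]
        have e5 : ∀ x : ℝ, wFun A v (flatEnergy b z) * flatZero b j z *
            (flatEnergy b z * (A + 2 * v (flatEnergy b z)) * x)
            = flatZero b j z * flatEnergy b z * x
              * (-v (flatEnergy b z) / (A * flatEnergy b z ^ 2)) := fun x => by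
          rw [← e4]; ring
        rw [e3, e1, e5]
        field_simp
        ring

theorem flatH_mul_flatG (hz : z.1 ∈ U) (hA : A ≠ 0) (ht : flatEnergy b z ≠ 0)
    (hAv : A + 2 * v (flatEnergy b z) ≠ 0) :
    (Matrix.of fun i j => flatH b A v i j z) * (Matrix.of fun i j => flatG a b A v i j z) = 1 :=
  mul_eq_one_comm.1 (flatG_mul_flatH h hz hA ht hAv)

/-- Expresses the vertical frame through `J` and the horizontal one, which reduces all components of
`N` to the horizontal ones. -/
theorem sum_flatH_smul_flatJ_flatHor (hz : z.1 ∈ U) (hA : A ≠ 0) (ht : flatEnergy b z ≠ 0)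
    (hAv : A + 2 * v (flatEnergy b z) ≠ 0) (j : Fin n) :
    ∑ r, flatH b A v j r z • flatJ a b Γ A v z (flatHor Γ r z) = ((0, stdVec j) : E n × E n) := by
  simp only [flatJ_flatHor h hz]
  rw [flatVer_sum_smul, ← flatVer_single]
  refine congrArg _ (funext fun k => ?_)
  rw [← flatH_mul_flatG h hz hA ht hAv, Matrix.mul_apply]
  rfl

theorem flatJ_flatJ (hz : z.1 ∈ U) (hA : A ≠ 0) (ht : flatEnergy b z ≠ 0)
    (hAv : A + 2 * v (flatEnergy b z) ≠ 0) (u : E n × E n) :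
    flatJ a b Γ A v z (flatJ a b Γ A v z u) = -u := by
  have hΓ : ∀ i j, flatChristoffelZero Γ i j z = flatChristoffelZero Γ j i z := fun i j => by
    simp only [flatChristoffelZero, h.torsion_free _ hz _ i j]
  have h1 : ∀ i, flatJ a b Γ A v z (flatJ a b Γ A v z (flatHor Γ i z)) = -flatHor Γ i z := by
    intro i
    rw [flatJ_flatHor h hz, flatJ_flatVer]
    simp only [Finset.smul_sum, smul_smul]
    rw [Finset.sum_comm]
    simp only [← Finset.sum_smul]
    have : ∀ k, ∑ l, flatG a b A v i l z * flatH b A v l k z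
      = (1 : Matrix (Fin n) (Fin n) ℝ) i k := fun k => by
      rw [← flatG_mul_flatH h hz hA ht hAv, Matrix.mul_apply]; rfl
    simp [this, Matrix.one_apply, ite_smul]
  have h2 : ∀ x, flatJ a b Γ A v z (flatJ a b Γ A v z (flatVer x)) = -flatVer x := by
    intro x
    rw [flatJ_flatVer, map_neg, map_sum]
    simp only [map_smul, map_sum, sum_flatH_smul_flatJ_flatHor h hz hA ht hAv]
    rw [flatVer_eq_sum]
  rw [eq_sum_flatHor_add_flatVer Γ z u hΓ]
  simp only [map_add, map_sum, map_smul, h1, h2, smul_neg, Finset.sum_neg_distrib, neg_add]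

theorem differentiableAt_flatZero (hz : z.1 ∈ U) (i : Fin n) :
    DifferentiableAt ℝ (flatZero b i) z :=
  DifferentiableAt.fun_sum fun j _ => (hasFDerivAt_snd_apply j z).differentiableAt.fun_mul
    (hasFDerivAt_comp_fst (h.differentiableAt_inv z.1 hz j i)).differentiableAt

theorem differentiableAt_flatH (hz : z.1 ∈ U) (hA : A ≠ 0) (ht : flatEnergy b z ≠ 0)
    (hAv : A + 2 * v (flatEnergy b z) ≠ 0) (hv : DifferentiableAt ℝ v (flatEnergy b z))
    (i j : Fin n) : DifferentiableAt ℝ (flatH b A v i j) z := by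
  have h1 := differentiableAt_flatEnergy h hz
  have h2 := differentiableAt_flatZero h hz
  have h3 := (hasFDerivAt_comp_fst (h.differentiableAt_inv z.1 hz i j)).differentiableAt
  have h4 : DifferentiableAt ℝ (fun y => v (flatEnergy b y)) z := hv.comp z h1
  have h5' : A * flatEnergy b z ≠ 0 := mul_ne_zero hA ht
  have h5 : DifferentiableAt ℝ (fun y => 1 / (A * flatEnergy b y)) z := by
    simp only [one_div]
    exact (h1.const_mul A).fun_inv h5'
  have h6' : A * flatEnergy b z ^ 2 * (A + 2 * v (flatEnergy b z)) ≠ 0 :=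
    mul_ne_zero (mul_ne_zero hA (pow_ne_zero 2 ht)) hAv
  have h6 : DifferentiableAt ℝ (fun y => wFun A v (flatEnergy b y)) z := by
    simp only [wFun, div_eq_mul_inv]
    exact h4.fun_neg.fun_mul ((((h1.fun_pow 2).const_mul A).fun_mul
      ((h4.const_mul 2).const_add A)).fun_inv h6')
  exact (h5.fun_mul h3).fun_add ((h6.fun_mul (h2 i)).fun_mul (h2 j))

/-- `J² = -1` and the expression of the vertical frame enter brackets, so they must hold near `z`
and not only at `z`. -/
theorem eventually_nondegenerate (hz : z.1 ∈ U) (ht : flatEnergy b z ≠ 0)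
    (hAv : A + 2 * v (flatEnergy b z) ≠ 0) (hv : DifferentiableAt ℝ v (flatEnergy b z)) :
    ∀ᶠ y in 𝓝 z, y.1 ∈ U ∧ flatEnergy b y ≠ 0 ∧ A + 2 * v (flatEnergy b y) ≠ 0 := by
  have h1 := differentiableAt_flatEnergy h hz
  have h4 : DifferentiableAt ℝ (fun y => A + 2 * v (flatEnergy b y)) z :=
    ((hv.comp z h1).const_mul 2).const_add A
  filter_upwards [(h.isOpen.preimage continuous_fst).mem_nhds hz, h1.continuousAt.eventually_ne ht,
    h4.continuousAt.eventually_ne hAv] with y h1 h2 h3 using ⟨h1, h2, h3⟩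

omit h in
theorem differentiableAt_flatVer {x : Fin n → E n × E n → ℝ} (hx : ∀ i, DifferentiableAt ℝ (x i) z)
    (c : E n) : DifferentiableAt ℝ (fun y => ((c, WithLp.toLp 2 fun i => x i y) : E n × E n)) z :=
  (differentiableAt_const c).prodMk
    ((PiLp.continuousLinearEquiv 2 ℝ (fun _ : Fin n => ℝ)).symm.differentiableAt.comp z
      (differentiableAt_pi.2 hx))

theorem flatNijenhuis_ver_right (hz : z.1 ∈ U) (hA : A ≠ 0) (ht : flatEnergy b z ≠ 0)
    (hAv : A + 2 * v (flatEnergy b z) ≠ 0) (hv : DifferentiableAt ℝ v (flatEnergy b z))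
    (X : E n × E n → E n × E n) (j : Fin n) :
    flatNijenhuis (flatJ a b Γ A v) X (fun _ => (0, stdVec j)) z
      = -∑ r, flatH b A v j r z • flatJ a b Γ A v z
          (flatNijenhuis (flatJ a b Γ A v) X (flatHor Γ r) z) := by
  have hev := eventually_nondegenerate h hz ht hAv hv
  have hJJ : ∀ᶠ y in 𝓝 z, ∀ u, flatJ a b Γ A v y (flatJ a b Γ A v y u) = -u := by
    filter_upwards [hev] with y hy using flatJ_flatJ h hy.1 hA hy.2.1 hy.2.2
  have hver : (fun _ => ((0, stdVec j) : E n × E n)) =ᶠ[𝓝 z]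
      fun y => ∑ r, flatH b A v j r y • flatJ a b Γ A v y (flatHor Γ r y) := by
    filter_upwards [hev] with y hy using
      (sum_flatH_smul_flatJ_flatHor h hy.1 hA hy.2.1 hy.2.2 j).symm
  have hhor : ∀ r, DifferentiableAt ℝ (flatHor Γ r) z := fun r =>
    differentiableAt_flatVer (differentiableAt_flatChristoffelZero h hz r) _
  have hJhor : ∀ r, DifferentiableAt ℝ (fun y => flatJ a b Γ A v y (flatHor Γ r y)) z := by
    intro r
    refine (differentiableAt_flatVer (differentiableAt_flatG (A := A) h hz hv r)
      0).congr_of_eventuallyEq ?_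
    filter_upwards [hev] with y hy using flatJ_flatHor h hy.1 r
  have hJJhor : ∀ r, DifferentiableAt ℝ
      (fun y => flatJ a b Γ A v y (flatJ a b Γ A v y (flatHor Γ r y))) z := by
    intro r
    refine (hhor r).neg.congr_of_eventuallyEq ?_
    filter_upwards [hJJ] with y hy using hy _
  rw [flatNijenhuis_congr_right hver, flatNijenhuis_sum_smul_right
    (fun r _ => differentiableAt_flatH h hz hA ht hAv hv j r) (fun r _ => hJhor r)
    (fun r _ => hJJhor r) hJJ.self_of_nhds, ← Finset.sum_neg_distrib]
  refine Finset.sum_congr rfl fun r _ => ?_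
  rw [flatNijenhuis_apply_right hJJ, smul_neg]

theorem flatNijenhuis_flatHor_ver (hz : z.1 ∈ U) (hA : A ≠ 0) (ht : flatEnergy b z ≠ 0)
    (hAv : A + 2 * v (flatEnergy b z) ≠ 0) (hv : DifferentiableAt ℝ v (flatEnergy b z))
    (i j : Fin n) :
    flatNijenhuis (flatJ a b Γ A v) (flatHor Γ i) (fun _ => (0, stdVec j)) z
      = ∑ k, (∑ l, ∑ r, flatH b A v k l z * flatH b A v j r z * flatT a b Γ A v l i r z)
          • flatHor Γ k z := by
  rw [flatNijenhuis_ver_right h hz hA ht hAv hv]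
  simp only [flatNijenhuis_flatHor_flatHor h hz hv, flatJ_flatVer, smul_neg,
    Finset.sum_neg_distrib, neg_neg, Finset.smul_sum, Finset.sum_smul, smul_smul]
  have e1 : ∀ r, ∑ l, ∑ k, (flatH b A v j r z * (flatT a b Γ A v l i r z * flatH b A v l k z))
      • flatHor Γ k z = ∑ k, ∑ l,
      (flatH b A v j r z * (flatT a b Γ A v l i r z * flatH b A v l k z)) • flatHor Γ k z :=
    fun r => Finset.sum_comm
  simp only [e1]
  rw [Finset.sum_comm]
  refine Finset.sum_congr rfl fun k _ => ?_
  rw [Finset.sum_comm]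
  refine Finset.sum_congr rfl fun l _ => Finset.sum_congr rfl fun r _ => ?_
  rw [flatH_symm h hz k l]
  congr 1
  ring

/-- The reduction is applied in both slots, with antisymmetry in between; the two factors `J`
compose to `-1`, so the result is vertical again. -/
theorem flatNijenhuis_ver_ver (hz : z.1 ∈ U) (hA : A ≠ 0) (ht : flatEnergy b z ≠ 0)
    (hAv : A + 2 * v (flatEnergy b z) ≠ 0) (hv : DifferentiableAt ℝ v (flatEnergy b z))
    (i j : Fin n) :
    flatNijenhuis (flatJ a b Γ A v) (fun _ => (0, stdVec i)) (fun _ => (0, stdVec j)) z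
      = flatVer fun k => ∑ l, ∑ r, flatH b A v i r z * flatH b A v j l z *
          flatT a b Γ A v k l r z := by
  have hJJ := flatJ_flatJ h hz hA ht hAv
  have e1 : ∀ r, flatNijenhuis (flatJ a b Γ A v) (flatHor Γ r) (fun _ => (0, stdVec i)) z
      = -∑ l, flatH b A v i l z • flatJ a b Γ A v z (flatVer fun k => flatT a b Γ A v k r l z) := by
    intro r
    rw [flatNijenhuis_ver_right h hz hA ht hAv hv]
    simp only [flatNijenhuis_flatHor_flatHor h hz hv]
  rw [flatNijenhuis_ver_right h hz hA ht hAv hv]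
  have e2 : ∀ r, flatJ a b Γ A v z
      (flatNijenhuis (flatJ a b Γ A v) (fun _ => (0, stdVec i)) (flatHor Γ r) z)
      = -flatVer fun k => ∑ l, flatH b A v i l z * flatT a b Γ A v k r l z := by
    intro r
    rw [flatNijenhuis_swap, e1, neg_neg, map_sum]
    simp only [map_smul, hJJ, smul_neg, Finset.sum_neg_distrib]
    rw [flatVer_sum_smul]
  simp only [e2, smul_neg, Finset.sum_neg_distrib, neg_neg]
  rw [flatVer_sum_smul]
  refine congrArg _ (funext fun k => Finset.sum_congr rfl fun l _ => ?_)
  rw [Finset.mul_sum]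
  exact Finset.sum_congr rfl fun r _ => by ring

end Coordinates

/-! ### Smoothness of the metric data; the Levi-Civita identities in a chart. -/

section LeviCivita

theorem contDiffAt_det {m : Type*} [Fintype m] [DecidableEq m] {F : Type*} [NormedAddCommGroup F]
    [NormedSpace ℝ F] {k : WithTop ℕ∞} {a : F → Matrix m m ℝ} {x : F}
    (ha : ∀ i j, ContDiffAt ℝ k (fun y => a y i j) x) : ContDiffAt ℝ k (fun y => (a y).det) x := by
  simp only [Matrix.det_apply, Units.smul_def, zsmul_eq_mul]
  exact ContDiffAt.sum fun σ _ => contDiffAt_const.mul (contDiffAt_prod fun i _ => ha _ _)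

theorem contDiffAt_matrix_inv {m : Type*} [Fintype m] [DecidableEq m] {F : Type*}
    [NormedAddCommGroup F] [NormedSpace ℝ F] {k : WithTop ℕ∞} {a : F → Matrix m m ℝ} {x : F}
    (ha : ∀ i j, ContDiffAt ℝ k (fun y => a y i j) x) (hx : (a x).det ≠ 0) (i j : m) :
    ContDiffAt ℝ k (fun y => (a y)⁻¹ i j) x := by
  simp only [Matrix.inv_def, Ring.inverse_eq_inv', Matrix.smul_apply, smul_eq_mul,
    Matrix.adjugate_apply]
  refine ((contDiffAt_det ha).inv hx).mul (contDiffAt_det fun i' j' => ?_)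
  by_cases h : i' = j
  · subst h
    simp only [Matrix.updateRow_self]
    exact contDiffAt_const
  · simp only [Matrix.updateRow_ne h]
    exact ha _ _

variable {n : ℕ}

/-- Uniqueness of the Levi-Civita connection. -/
theorem christoffel_formula_eq {a b : Matrix (Fin n) (Fin n) ℝ} {D C : Fin n → Fin n → Fin n → ℝ}
    (hab : b * a = 1) (ha : ∀ i j, a i j = a j i) (hC : ∀ k i j, C k i j = C k j i)
    (hD : ∀ k i j, D k i j = ∑ l, (C l k i * a l j + C l k j * a i l)) (k i j : Fin n) :
    (1 / 2) * ∑ l, b k l * (D i j l + D j i l - D l i j) = C k i j := by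
  -- Koszul's argument: in the alternating sum of three compatibility equations, symmetry of `C` and
  -- `a` leaves one term, twice.
  have h1 : ∀ l, D i j l + D j i l - D l i j = 2 * ∑ m, a l m * C m i j := by
    intro l
    rw [hD, hD, hD, ← Finset.sum_add_distrib, ← Finset.sum_sub_distrib, Finset.mul_sum]
    refine Finset.sum_congr rfl fun m _ => ?_
    rw [hC m j i, hC m l i, hC m l j, ha l m, ha j m]
    ring
  have h2 : ∑ l, b k l * ∑ m, a l m * C m i j = C k i j := by
    have := congrFun (congrArg (fun x : Matrix (Fin n) (Fin n) ℝ => x.mulVec fun m => C m i j) hab) k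
    simp only [← Matrix.mulVec_mulVec, Matrix.one_mulVec] at this
    exact this
  calc _ = (1 / 2) * (2 * ∑ l, b k l * ∑ m, a l m * C m i j) := by
        congr 1
        rw [Finset.mul_sum]
        exact Finset.sum_congr rfl fun l _ => by rw [h1]; ring
    _ = _ := by rw [h2]; ring

/-- The Levi-Civita connection is compatible with the metric. -/
theorem compat_of_christoffel_formula {a b : Matrix (Fin n) (Fin n) ℝ}
    {D C : Fin n → Fin n → Fin n → ℝ}
    (hab : a * b = 1) (ha : ∀ i j, a i j = a j i) (hD : ∀ k i j, D k i j = D k j i)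
    (hC : ∀ k i j, C k i j = (1 / 2) * ∑ l, b k l * (D i j l + D j i l - D l i j)) (k i j : Fin n) :
    D k i j = ∑ l, (C l k i * a l j + C l k j * a i l) := by
  have h1 : ∀ l i j, ∑ m, a l m * C m i j = (1 / 2) * (D i j l + D j i l - D l i j) := by
    intro l i j
    have := congrFun (congrArg (fun x : Matrix (Fin n) (Fin n) ℝ =>
      x.mulVec fun l => D i j l + D j i l - D l i j) hab) l
    simp only [← Matrix.mulVec_mulVec, Matrix.one_mulVec] at this
    rw [← this]
    simp only [Matrix.mulVec, dotProduct, hC, Finset.mul_sum]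
    exact Finset.sum_congr rfl fun m _ => Finset.sum_congr rfl fun l _ => by ring
  have h2 : ∑ l, (C l k i * a l j + C l k j * a i l)
      = ∑ m, a j m * C m k i + ∑ m, a i m * C m k j := by
    rw [← Finset.sum_add_distrib]
    exact Finset.sum_congr rfl fun m _ => by rw [ha m j]; ring
  rw [h2, h1, h1, hD i k j, hD j k i, hD k j i]
  ring

variable {M : Type*} [TopologicalSpace M] [ChartedSpace (E n) M]
  [IsManifold 𝓘(ℝ, E n) ∞ M] {e : OpenPartialHomeomorph M (E n)}

theorem contDiffAt_gUp (g : Metric n M) (he : e ∈ IsManifold.maximalAtlas 𝓘(ℝ, E n) ∞ M)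
    {q : E n} (hq : q ∈ e.target) (i j : Fin n) : ContDiffAt ℝ ∞ (fun y => gUp g e y i j) q :=
  contDiffAt_matrix_inv (contDiffAt_gLow g he hq) (gLow_posDef g he hq).det_pos.ne' i j

theorem contDiffAt_pderiv {f : E n → ℝ} {q : E n} (hf : ContDiffAt ℝ ∞ f q) (i : Fin n) :
    ContDiffAt ℝ ∞ (pderiv i f) q :=
  (hf.fderiv_right (m := ∞) (by simp)).clm_apply contDiffAt_const

theorem contDiffAt_christoffel (g : Metric n M) (he : e ∈ IsManifold.maximalAtlas 𝓘(ℝ, E n) ∞ M)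
    {q : E n} (hq : q ∈ e.target) (k i j : Fin n) : ContDiffAt ℝ ∞ (christoffel g e k i j) q :=
  contDiffAt_const.mul (ContDiffAt.sum fun l _ => (contDiffAt_gUp g he hq k l).mul
    (((contDiffAt_pderiv (contDiffAt_gLow g he hq j l) i).add
      (contDiffAt_pderiv (contDiffAt_gLow g he hq i l) j)).sub
      (contDiffAt_pderiv (contDiffAt_gLow g he hq i j) l)))

theorem gLow_symm (g : Metric n M) (q : E n) (i j : Fin n) : gLow g e q i j = gLow g e q j i :=
  g.symm _ _ _

theorem isLeviCivita (g : Metric n M) (he : e ∈ IsManifold.maximalAtlas 𝓘(ℝ, E n) ∞ M) :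
    IsLeviCivita e.target (gLow g e) (gUp g e) (christoffel g e) := by
  have hinv : ∀ q ∈ e.target, gLow g e q * gUp g e q = 1 := fun q hq =>
    Matrix.mul_nonsing_inv _ (gLow_posDef g he hq).det_pos.ne'.isUnit
  refine ⟨e.open_target, fun q _ => gLow_symm g q, hinv,
    fun q hq i j => (contDiffAt_gLow g he hq i j).differentiableAt (by simp),
    fun q hq i j => (contDiffAt_gUp g he hq i j).differentiableAt (by simp),
    fun q hq k i j => (contDiffAt_christoffel g he hq k i j).differentiableAt (by simp), ?_, ?_⟩
  · intro q _ k i j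
    simp only [christoffel, gLow_symm (e := e) g _ i j, add_comm (pderiv i _ _)]
  · intro q hq k i j
    exact compat_of_christoffel_formula (D := fun k i j => pderiv k (fun y => gLow g e y i j) q)
      (C := fun k i j => christoffel g e k i j q)
      (hinv q hq) (gLow_symm g q) (fun k i j => by simp only [gLow_symm (e := e) g _ i j])
      (fun k i j => rfl) k i j

/-- Positivity, beyond `t ≠ 0`, places `t` in the interval where `v` is smooth. -/
theorem flatEnergy_pos {a b : E n → Matrix (Fin n) (Fin n) ℝ} {z : E n × E n}
    (hab : b z.1 = (a z.1)⁻¹) (ha : (a z.1).PosDef) (hz : z.2 ≠ 0) : 0 < flatEnergy b z := by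
  have hb : (b z.1).PosDef := hab ▸ ha.inv
  have hz' : (fun i => z.2 i) ≠ 0 := fun h => hz (PiLp.ext fun i => congrFun h i)
  have := hb.dotProduct_mulVec_pos hz'
  refine mul_pos (by norm_num) (lt_of_lt_of_eq this ?_)
  simp only [dotProduct, Matrix.mulVec, Finset.mul_sum]
  exact Finset.sum_congr rfl fun i _ => Finset.sum_congr rfl fun j _ => by simp; ring

end LeviCivita

/-! ### Jacobians and the transformation law of the Christoffel symbols. -/

section Transition

variable {n : ℕ}

/-- The matrix of partial derivatives of the entries. -/
def pderivMatrix (k : Fin n) (N : E n → Matrix (Fin n) (Fin n) ℝ) (q : E n) :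
    Matrix (Fin n) (Fin n) ℝ :=
  Matrix.of fun i j => pderiv k (fun y => N y i j) q

theorem pderivMatrix_mul {N K : E n → Matrix (Fin n) (Fin n) ℝ} {q : E n}
    (hN : ∀ i j, DifferentiableAt ℝ (fun y => N y i j) q)
    (hK : ∀ i j, DifferentiableAt ℝ (fun y => K y i j) q) (k : Fin n) :
    pderivMatrix k (fun y => N y * K y) q = pderivMatrix k N q * K q + N q * pderivMatrix k K q := by
  ext i j
  simp only [pderivMatrix, Matrix.of_apply, Matrix.add_apply, Matrix.mul_apply, pderiv]
  rw [fderiv_fun_sum fun m _ => (hN i m).fun_mul (hK m j), sum_apply, ← Finset.sum_add_distrib]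
  refine Finset.sum_congr rfl fun m _ => ?_
  rw [fderiv_fun_mul (hN i m) (hK m j)]
  simp only [add_apply, smul_apply, smul_eq_mul]
  ring

theorem differentiableAt_matrix_mul {N K : E n → Matrix (Fin n) (Fin n) ℝ} {q : E n}
    (hN : ∀ i j, DifferentiableAt ℝ (fun y => N y i j) q)
    (hK : ∀ i j, DifferentiableAt ℝ (fun y => K y i j) q) (i j : Fin n) :
    DifferentiableAt ℝ (fun y => (N y * K y) i j) q := by
  simp only [Matrix.mul_apply]
  exact DifferentiableAt.fun_sum fun m _ => (hN i m).fun_mul (hK m j)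

theorem fderiv_apply_eq_sum_pderiv {f : E n → ℝ} {q : E n} (w : E n) :
    fderiv ℝ f q w = ∑ i, w i * pderiv i f q := by
  have hw : w = ∑ i, w i • stdVec i := by
    refine PiLp.ext fun j => ?_
    simp [stdVec, Pi.single_apply]
  conv_lhs => rw [hw, map_sum]
  simp only [map_smul, smul_eq_mul, pderiv]

/-- The Jacobian matrix `∂φᵃ/∂xⁱ`. -/
def jacobian (φ : E n → E n) (y : E n) : Matrix (Fin n) (Fin n) ℝ :=
  Matrix.of fun c i => pderiv i (fun y => φ y c) y

theorem fderiv_apply_eq_sum_jacobian {φ : E n → E n} {q : E n} (hφ : DifferentiableAt ℝ φ q)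
    (w : E n) (c : Fin n) : fderiv ℝ φ q w c = ∑ i, jacobian φ q c i * w i := by
  have h1 : fderiv ℝ φ q w c = fderiv ℝ (fun y => φ y c) q w := by
    have := ((EuclideanSpace.proj c : E n →L[ℝ] ℝ).hasFDerivAt.comp q hφ.hasFDerivAt).fderiv
    exact (congrArg (fun f => f w) this).symm
  rw [h1, fderiv_apply_eq_sum_pderiv]
  exact Finset.sum_congr rfl fun i _ => mul_comm _ _

theorem pderivMatrix_comp {N : E n → Matrix (Fin n) (Fin n) ℝ} {φ : E n → E n} {q : E n}
    (hφ : DifferentiableAt ℝ φ q)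
    (hN : ∀ i j, DifferentiableAt ℝ (fun y => N y i j) (φ q)) (k : Fin n) :
    pderivMatrix k (fun y => N (φ y)) q = ∑ c, jacobian φ q c k • pderivMatrix c N (φ q) := by
  ext i j
  simp only [pderivMatrix, Matrix.of_apply, Matrix.sum_apply, Matrix.smul_apply, smul_eq_mul]
  have h1 := ((hN i j).hasFDerivAt.comp q hφ.hasFDerivAt).fderiv
  refine (congrArg (fun f => f (stdVec k)) h1).trans ?_
  change fderiv ℝ (fun y => N y i j) (φ q) (fderiv ℝ φ q (stdVec k)) = _
  rw [fderiv_apply_eq_sum_pderiv]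
  refine Finset.sum_congr rfl fun c _ => ?_
  rw [fderiv_apply_eq_sum_jacobian hφ]
  simp [stdVec]

theorem contDiffAt_jacobian {φ : E n → E n} {q : E n} (hφ : ContDiffAt ℝ ∞ φ q) (c i : Fin n) :
    ContDiffAt ℝ ∞ (fun y => jacobian φ y c i) q :=
  contDiffAt_pderiv ((EuclideanSpace.proj c : E n →L[ℝ] ℝ).contDiff.contDiffAt.comp q hφ) i

theorem pderiv_jacobian_comm {φ : E n → E n} {q : E n} (hφ : ContDiffAt ℝ ∞ φ q) (c i k : Fin n) :
    pderiv k (fun y => jacobian φ y c i) q = pderiv i (fun y => jacobian φ y c k) q := by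
  have hf : ContDiffAt ℝ ∞ (fun y => φ y c) q :=
    (EuclideanSpace.proj c : E n →L[ℝ] ℝ).contDiff.contDiffAt.comp q hφ
  have hd : DifferentiableAt ℝ (fderiv ℝ fun y => φ y c) q :=
    (hf.fderiv_right (m := ∞) (by simp)).differentiableAt (by simp)
  have h1 : ∀ i k, pderiv k (fun y => jacobian φ y c i) q
      = fderiv ℝ (fderiv ℝ fun y => φ y c) q (stdVec k) (stdVec i) := by
    intro i k
    have := hd.hasFDerivAt.clm_apply (hasFDerivAt_const (stdVec i) q)
    refine (congrArg (fun f => f (stdVec k)) this.fderiv).trans ?_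
    simp
  rw [h1, h1]
  refine (hf.isSymmSndFDerivAt ?_).eq _ _
  rw [minSmoothness_of_isRCLikeNormedField]
  exact WithTop.coe_le_coe.2 (le_top : (2 : ℕ∞) ≤ ⊤)

variable {U U' : Set (E n)} {a b a' b' : E n → Matrix (Fin n) (Fin n) ℝ}
  {Γ Γ' : Fin n → Fin n → Fin n → E n → ℝ} {φ : E n → E n} {q : E n}

theorem IsLeviCivita.pderivMatrix_eq (h : IsLeviCivita U a b Γ) (hq : q ∈ U) (k : Fin n) :
    pderivMatrix k a q = (Matrix.of fun l j => Γ l k j q).transpose * a q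
      + a q * Matrix.of fun l j => Γ l k j q := by
  ext i j
  simp only [pderivMatrix, Matrix.of_apply, h.compat q hq, Matrix.add_apply, Matrix.mul_apply,
    ← Finset.sum_add_distrib, Matrix.transpose_apply]
  exact Finset.sum_congr rfl fun l _ => by ring

/-- The transformation law of the Christoffel symbols. -/
theorem sum_jacobian_mul_christoffel (h : IsLeviCivita U a b Γ) (h' : IsLeviCivita U' a' b' Γ')
    (hΓ : ∀ k i j, Γ k i j q = (1 / 2) * ∑ l, b q k l * (pderiv i (fun y => a y j l) q
      + pderiv j (fun y => a y i l) q - pderiv l (fun y => a y i j) q))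
    (hq : q ∈ U) (hq' : φ q ∈ U') (hφ : ContDiffAt ℝ ∞ φ q)
    (hB : IsUnit (jacobian φ q).det)
    (ha : ∀ᶠ y in 𝓝 q, a y = (jacobian φ y).transpose * a' (φ y) * jacobian φ y)
    (c i j : Fin n) :
    ∑ k, jacobian φ q c k * Γ k i j q = pderiv i (fun y => jacobian φ y c j) q
      + ∑ d, ∑ m, jacobian φ q d i * jacobian φ q m j * Γ' c d m (φ q) := by
  set B := jacobian φ q with hBdef
  -- `S k` is the derivative of the Jacobian plus the pulled-back symbols of `Γ'`, so `B⁻¹ * S k` is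
  -- the pullback connection by `φ`.
  set S : Fin n → Matrix (Fin n) (Fin n) ℝ := fun k => pderivMatrix k (jacobian φ) q
    + (∑ d, B d k • Matrix.of fun l m => Γ' l d m (φ q)) * B with hS
  have hSapp : ∀ c i j, S i c j = pderiv i (fun y => jacobian φ y c j) q
      + ∑ d, ∑ m, B d i * B m j * Γ' c d m (φ q) := by
    intro c i j
    simp only [hS, Matrix.add_apply, pderivMatrix, Matrix.of_apply, Matrix.mul_apply,
      Matrix.sum_apply, Matrix.smul_apply, smul_eq_mul, Finset.sum_mul]
    exact congrArg _ (Finset.sum_congr rfl fun d _ => Finset.sum_congr rfl fun m _ => by ring)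
  have hBi : B * B⁻¹ = 1 := Matrix.mul_nonsing_inv _ hB
  have hBS : ∀ k, B * (B⁻¹ * S k) = S k := fun k => by rw [← mul_assoc, hBi, one_mul]
  -- The pullback connection is symmetric, by equality of mixed second derivatives of `φ`, and
  -- compatible with `a = Bᵀ a' B`; uniqueness then identifies it with `Γ`.
  have key : ∀ k i j, Γ k i j q = (B⁻¹ * S i) k j := by
    intro k i j
    rw [hΓ]
    refine christoffel_formula_eq (a := a q) (C := fun k i j => (B⁻¹ * S i) k j)
      (D := fun k i j => pderiv k (fun y => a y i j) q)
      (h.inv_mul hq) (h.symm q hq) ?_ ?_ k i j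
    · intro k i j
      simp only [Matrix.mul_apply]
      refine Finset.sum_congr rfl fun c _ => ?_
      rw [hSapp, hSapp, pderiv_jacobian_comm hφ, Finset.sum_comm]
      refine congrArg _ (congrArg _ (Finset.sum_congr rfl fun d _ => Finset.sum_congr rfl
        fun m _ => ?_))
      rw [h'.torsion_free _ hq' c m d]
      ring
    · intro k i j
      have e1 : pderivMatrix k a q
          = pderivMatrix k (fun y => (jacobian φ y).transpose * a' (φ y) * jacobian φ y) q := by
        ext i j
        simp only [pderivMatrix, Matrix.of_apply, pderiv]
        have : (fun y => a y i j) =ᶠ[𝓝 q]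
            fun y => ((jacobian φ y).transpose * a' (φ y) * jacobian φ y) i j := by
          filter_upwards [ha] with y hy using by rw [hy]
        rw [this.fderiv_eq]
      have hJ : ∀ i j, DifferentiableAt ℝ (fun y => jacobian φ y i j) q := fun i j =>
        (contDiffAt_jacobian hφ i j).differentiableAt (by simp)
      have hφd : DifferentiableAt ℝ φ q := hφ.differentiableAt (by simp)
      have ha' : ∀ i j, DifferentiableAt ℝ (fun y => a' (φ y) i j) q := fun i j =>
        (h'.differentiableAt _ hq' i j).comp q hφd
      have e2 : pderivMatrix k (fun y => (jacobian φ y).transpose) q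
          = (pderivMatrix k (jacobian φ) q).transpose := rfl
      rw [pderivMatrix_mul (differentiableAt_matrix_mul (N := fun y => (jacobian φ y).transpose)
        (fun i j => hJ j i) ha') hJ, pderivMatrix_mul (N := fun y => (jacobian φ y).transpose)
        (fun i j => hJ j i) ha', e2, pderivMatrix_comp hφd (h'.differentiableAt _ hq')] at e1
      simp only [h'.pderivMatrix_eq hq', smul_add, Finset.sum_add_distrib] at e1
      set X : Matrix (Fin n) (Fin n) ℝ := ∑ d, B d k • Matrix.of fun l m => Γ' l d m (φ q) with hX
      have e3 : ∑ d, B d k • ((Matrix.of fun l m => Γ' l d m (φ q)).transpose * a' (φ q))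
          = X.transpose * a' (φ q) := by
        simp only [hX, Matrix.transpose_sum, Matrix.transpose_smul, Finset.sum_mul, smul_mul_assoc]
      have e4 : ∑ d, B d k • (a' (φ q) * (Matrix.of fun l m => Γ' l d m (φ q)))
          = a' (φ q) * X := by
        simp only [hX, Finset.mul_sum, mul_smul_comm]
      rw [e3, e4] at e1
      have e5 : pderivMatrix k a q = (B⁻¹ * S k).transpose * a q + a q * (B⁻¹ * S k) := by
        have e6 : a q * (B⁻¹ * S k) = B.transpose * a' (φ q) * S k := by
          rw [ha.self_of_nhds, mul_assoc, hBS]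
        have e7 : (B⁻¹ * S k).transpose * a q = (S k).transpose * a' (φ q) * B := by
          rw [ha.self_of_nhds]
          calc (B⁻¹ * S k).transpose * (B.transpose * a' (φ q) * B)
              = (B * (B⁻¹ * S k)).transpose * a' (φ q) * B := by
                rw [Matrix.transpose_mul B]; simp only [mul_assoc]
            _ = _ := by rw [hBS]
        rw [e6, e7, e1]
        simp only [hS, Matrix.transpose_add, Matrix.transpose_mul]
        noncomm_ring
      have e8 := congrFun (congrFun e5 i) j
      simp only [pderivMatrix, Matrix.of_apply] at e8
      rw [e8]
      simp only [Matrix.add_apply, Matrix.mul_apply (M := (B⁻¹ * S k).transpose),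
        Matrix.mul_apply (M := a q),
        Matrix.transpose_apply, ← Finset.sum_add_distrib]
      exact Finset.sum_congr rfl fun l _ => by ring
  rw [← hSapp, ← hBS i, Matrix.mul_apply]
  exact Finset.sum_congr rfl fun k _ => by rw [key]

end Transition

/-! ### Tensorial behaviour of `G`, `H` and `J` under a linear change of coframe. -/

section Transition

variable {n : ℕ} {a b a' b' : E n → Matrix (Fin n) (Fin n) ℝ} {z z' : E n × E n}
  {B : Matrix (Fin n) (Fin n) ℝ} {A : ℝ} {v : ℝ → ℝ}

theorem flatEnergy_transition (hb : b' z'.1 = B * b z.1 * B.transpose)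
    (hp : ∀ i, z.2 i = ∑ c, B c i * z'.2 c) : flatEnergy b z = flatEnergy b' z' := by
  have hE : ∀ (b : E n → Matrix (Fin n) (Fin n) ℝ) z, flatEnergy b z
      = (1 / 2) * ((fun i => z.2 i) ⬝ᵥ (b z.1).mulVec fun i => z.2 i) := by
    intro b z
    simp only [flatEnergy, dotProduct, Matrix.mulVec, Finset.mul_sum]
    exact Finset.sum_congr rfl fun i _ => Finset.sum_congr rfl fun k _ => by ring
  have hp' : (fun i => z.2 i) = B.transpose.mulVec fun c => z'.2 c := funext hp
  rw [hE, hE, hb, hp', ← Matrix.mulVec_mulVec, ← Matrix.mulVec_mulVec, Matrix.dotProduct_mulVec _ B,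
    Matrix.mulVec_transpose]

theorem flatZero_transition (hb : b' z'.1 = B * b z.1 * B.transpose)
    (hp : ∀ i, z.2 i = ∑ c, B c i * z'.2 c) (c : Fin n) :
    flatZero b' c z' = ∑ i, B c i * flatZero b i z := by
  have hZ : ∀ (b : E n → Matrix (Fin n) (Fin n) ℝ) z, (fun i => flatZero b i z)
      = Matrix.vecMul (fun i => z.2 i) (b z.1) := fun b z => rfl
  have hp' : (fun i => z.2 i) = Matrix.vecMul (fun c => z'.2 c) B := funext fun i =>
    (hp i).trans (Finset.sum_congr rfl fun c _ => mul_comm _ _)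
  have h2 : (fun c => flatZero b' c z') = B.mulVec fun i => flatZero b i z := by
    rw [hZ, hZ, hb, hp', ← Matrix.vecMul_vecMul, ← Matrix.vecMul_vecMul, Matrix.vecMul_transpose]
  exact congrFun h2 c

theorem flatG_transition (ha : a z.1 = B.transpose * a' z'.1 * B)
    (hb : b' z'.1 = B * b z.1 * B.transpose) (hp : ∀ i, z.2 i = ∑ c, B c i * z'.2 c) (i j : Fin n) :
    flatG a b A v i j z = ∑ c, ∑ d, B c i * B d j * flatG a' b' A v c d z' := by
  have h1 : a z.1 i j = ∑ c, ∑ d, B c i * B d j * a' z'.1 c d := by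
    rw [ha]
    simp only [Matrix.mul_apply, Matrix.transpose_apply, Finset.sum_mul]
    rw [Finset.sum_comm]
    exact Finset.sum_congr rfl fun c _ => Finset.sum_congr rfl fun d _ => by ring
  simp only [flatG]
  rw [flatEnergy_transition hb hp, h1, hp i, hp j, mul_assoc (v _), Finset.sum_mul_sum]
  simp only [Finset.mul_sum, ← Finset.sum_add_distrib]
  exact Finset.sum_congr rfl fun c _ => Finset.sum_congr rfl fun d _ => by ring

theorem flatH_transition (hb : b' z'.1 = B * b z.1 * B.transpose)
    (hp : ∀ i, z.2 i = ∑ c, B c i * z'.2 c) (c d : Fin n) :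
    flatH b' A v c d z' = ∑ i, ∑ j, B c i * B d j * flatH b A v i j z := by
  have h1 : b' z'.1 c d = ∑ i, ∑ j, B c i * B d j * b z.1 i j := by
    rw [hb]
    simp only [Matrix.mul_apply, Matrix.transpose_apply, Finset.sum_mul]
    rw [Finset.sum_comm]
    exact Finset.sum_congr rfl fun i _ => Finset.sum_congr rfl fun j _ => by ring
  simp only [flatH]
  rw [flatEnergy_transition hb hp, h1, flatZero_transition hb hp, flatZero_transition hb hp,
    mul_assoc (wFun _ _ _), Finset.sum_mul_sum]
  simp only [Finset.mul_sum, ← Finset.sum_add_distrib]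
  exact Finset.sum_congr rfl fun i _ => Finset.sum_congr rfl fun j _ => by ring

variable {Γ Γ' : Fin n → Fin n → Fin n → E n → ℝ}

theorem flatDp_apply (i : Fin n) (z w : E n × E n) :
    flatDp Γ i z w = w.2 i - ∑ j, flatChristoffelZero Γ i j z * w.1 j := by
  simp [flatDp]

theorem flatJ_fst (z w : E n × E n) (i : Fin n) :
    (flatJ a b Γ A v z w).1 i = -∑ j, flatDp Γ j z w * flatH b A v j i z := by
  simp [flatJ, flatVer, flatHor, Prod.fst_sum, stdVec, Pi.single_apply]

theorem flatDp_flatJ {U : Set (E n)} (h : IsLeviCivita U a b Γ) (hz : z.1 ∈ U) (w : E n × E n)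
    (i : Fin n) : flatDp Γ i z (flatJ a b Γ A v z w) = ∑ j, w.1 j * flatG a b A v j i z := by
  simp only [flatJ, sub_apply, sum_apply, ContinuousLinearMap.smulRight_apply, map_sub, map_sum,
    map_smul, flatDp_flatHor h hz, flatDp_flatVer]
  simp

/-- The almost complex structure in coordinates is invariant under a linear map that transforms
the adapted coframes into each other. -/
theorem flatJ_transition {U U' : Set (E n)} (h : IsLeviCivita U a b Γ)
    (h' : IsLeviCivita U' a' b' Γ') (hz : z.1 ∈ U) (hz' : z'.1 ∈ U')
    (hB : IsUnit B.det) (ha : a z.1 = B.transpose * a' z'.1 * B)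
    (hp : ∀ i, z.2 i = ∑ c, B c i * z'.2 c) (L : E n × E n → E n × E n)
    (hL : ∀ w c, (L w).1 c = ∑ i, B c i * w.1 i)
    (hLD : ∀ w i, flatDp Γ i z w = ∑ c, B c i * flatDp Γ' c z' (L w)) (w : E n × E n) :
    L (flatJ a b Γ A v z w) = flatJ a' b' Γ' A v z' (L w) := by
  have hBi : B * B⁻¹ = 1 := Matrix.mul_nonsing_inv _ hB
  -- The law for the inverse matrices follows from `ha` by uniqueness of inverses.
  have hb : b' z'.1 = B * b z.1 * B.transpose := by
    have h2 : (B * b z.1 * B.transpose) * a' z'.1 = 1 := by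
      calc (B * b z.1 * B.transpose) * a' z'.1
          = B * b z.1 * (B.transpose * a' z'.1 * B) * B⁻¹ := by
            simp only [mul_assoc, hBi, mul_one]
        _ = 1 := by rw [← ha, mul_assoc B, h.inv_mul hz, mul_one, hBi]
    calc b' z'.1 = ((B * b z.1 * B.transpose) * a' z'.1) * b' z'.1 := by rw [h2, one_mul]
      _ = _ := by rw [mul_assoc _ (a' z'.1), h'.mul_inv _ hz', mul_one]
  have hfst : ∀ c, (L (flatJ a b Γ A v z w)).1 c = (flatJ a' b' Γ' A v z' (L w)).1 c := by
    intro c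
    rw [hL, flatJ_fst]
    simp only [flatJ_fst, hLD, flatH_transition (A := A) (v := v) hb hp, mul_neg,
      Finset.sum_neg_distrib, Finset.mul_sum, Finset.sum_mul]
    rw [neg_inj]
    have e1 : ∀ i, ∑ j, ∑ d, B c i * (B d j * flatDp Γ' d z' (L w) * flatH b A v j i z)
        = ∑ d, ∑ j, B c i * (B d j * flatDp Γ' d z' (L w) * flatH b A v j i z) :=
      fun i => Finset.sum_comm
    simp only [e1]
    rw [Finset.sum_comm]
    refine Finset.sum_congr rfl fun d _ => ?_
    rw [Finset.sum_comm]
    exact Finset.sum_congr rfl fun j _ => Finset.sum_congr rfl fun i _ => by ring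
  have hDp : ∀ c, flatDp Γ' c z' (L (flatJ a b Γ A v z w))
      = flatDp Γ' c z' (flatJ a' b' Γ' A v z' (L w)) := by
    have e1 : B.transpose.mulVec (fun c => flatDp Γ' c z' (L (flatJ a b Γ A v z w)))
        = B.transpose.mulVec fun c => flatDp Γ' c z' (flatJ a' b' Γ' A v z' (L w)) := by
      funext i
      refine (hLD _ i).symm.trans ?_
      simp only [Matrix.mulVec, dotProduct, Matrix.transpose_apply, flatDp_flatJ h hz,
        flatDp_flatJ h' hz', hL, flatG_transition (A := A) (v := v) ha hb hp, Finset.mul_sum,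
        Finset.sum_mul]
      have e2 : ∀ j, ∑ c, ∑ d, w.1 j * (B c j * B d i * flatG a' b' A v c d z')
          = ∑ d, ∑ c, w.1 j * (B c j * B d i * flatG a' b' A v c d z') :=
        fun i => Finset.sum_comm
      simp only [e2]
      rw [Finset.sum_comm]
      refine Finset.sum_congr rfl fun d _ => ?_
      rw [Finset.sum_comm]
      exact Finset.sum_congr rfl fun j _ => Finset.sum_congr rfl fun i _ => by ring
    -- The coframe law `hLD` yields the equality only after multiplication by `Bᵀ`, which is then
    -- cancelled.
    have hBt : IsUnit B.transpose := by
      rw [Matrix.isUnit_iff_isUnit_det, Matrix.det_transpose]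
      exact hB
    exact congrFun (Matrix.mulVec_injective_of_isUnit hBt e1)
  refine Prod.ext (PiLp.ext hfst) (PiLp.ext fun c => ?_)
  -- Equal base components turn equality of the `Dp` components into equality of the fibre
  -- components.
  have := hDp c
  simp only [flatDp_apply, hfst] at this
  exact sub_left_injective this

end Transition

/-! ### Independence of `J` from the chart. -/

section Transition

variable {n : ℕ} {M : Type*} [TopologicalSpace M] [ChartedSpace (E n) M]
  [IsManifold 𝓘(ℝ, E n) ∞ M] {e e' : OpenPartialHomeomorph M (E n)}

theorem dChart_dp_vec (he : e ∈ IsManifold.maximalAtlas 𝓘(ℝ, E n) ∞ M) {P : Cotangent n M}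
    (hP : P.1 ∈ e.source) (i : Fin n) : dChart e P (dp_vec e i P) = (0, stdVec i) :=
  ((isInvertible_dChart he hP).inverse_apply_eq.1 rfl).symm

theorem flatHor_eq_sum (Γ : Fin n → Fin n → Fin n → E n → ℝ) (i : Fin n) (z : E n × E n) :
    flatHor Γ i z = (stdVec i, 0) + ∑ h, flatChristoffelZero Γ i h z • ((0, stdVec h) : E n × E n) := by
  rw [← flatVer_eq_sum]
  simp [flatHor, flatVer]

theorem map_flatHor {V : Type*} [AddCommGroup V] [Module ℝ V] [TopologicalSpace V]
    (L : E n × E n →L[ℝ] V) (Γ : Fin n → Fin n → Fin n → E n → ℝ) (i : Fin n) (z : E n × E n) :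
    L (flatHor Γ i z) = L (stdVec i, 0) + ∑ h, flatChristoffelZero Γ i h z • L (0, stdVec h) := by
  rw [flatHor_eq_sum, map_add, map_sum]
  simp only [map_smul]

theorem map_sum_smulRight_sub {V W : Type*} [AddCommGroup V] [Module ℝ V] [TopologicalSpace V]
    [IsTopologicalAddGroup V] [ContinuousSMul ℝ V] [AddCommGroup W] [Module ℝ W]
    [TopologicalSpace W] (L : V →L[ℝ] W) (α β : Fin n → V →L[ℝ] ℝ) (G H : Fin n → Fin n → ℝ)
    (X Y : Fin n → V) (ξ : V) :
    L (((∑ i, (α i).smulRight (∑ k, G i k • X k)) - ∑ i, (β i).smulRight (∑ k, H i k • Y k)) ξ)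
      = ∑ i, α i ξ • ∑ k, G i k • L (X k) - ∑ i, β i ξ • ∑ k, H i k • L (Y k) := by
  simp only [sub_apply, sum_apply, ContinuousLinearMap.smulRight_apply, map_sub, map_sum, map_smul]

theorem delta_vec_eq (g : Metric n M) (i : Fin n) (P : Cotangent n M) :
    delta_vec g e i P = (dChart e P).inverse (flatHor (christoffel g e) i (cotChart e P)) := by
  rw [map_flatHor (dChart e P).inverse (christoffel g e) i (cotChart e P)]
  rfl

theorem dChart_delta_vec (g : Metric n M) (he : e ∈ IsManifold.maximalAtlas 𝓘(ℝ, E n) ∞ M)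
    {P : Cotangent n M} (hP : P.1 ∈ e.source) (i : Fin n) :
    dChart e P (delta_vec g e i P) = flatHor (christoffel g e) i (cotChart e P) := by
  rw [delta_vec_eq]
  exact ((isInvertible_dChart he hP).inverse_apply_eq.1 rfl).symm

theorem dChart_JChart (g : Metric n M) (A : ℝ) (v : ℝ → ℝ)
    (he : e ∈ IsManifold.maximalAtlas 𝓘(ℝ, E n) ∞ M)
    {P : Cotangent n M} (hP : P.1 ∈ e.source) (ξ : TangentSpace (IT n) P) :
    dChart e P (JChart g A v e P ξ) = flatJ (gLow g e) (gUp g e) (christoffel g e) A v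
      (cotChart e P) (dChart e P ξ) := by
  have hDp : ∀ i, Dp_form g e i P ξ = flatDp (christoffel g e) i (cotChart e P) (dChart e P ξ) := by
    intro i
    simp only [Dp_form, flatDp, sub_apply, sum_apply, smul_apply]
    rfl
  refine (map_sum_smulRight_sub (dChart e P) (fun i => dq_form e i P) (fun i => Dp_form g e i P)
    (fun i k => GLow g A v e i k P) (fun i k => HUp g A v e i k P) (fun k => dp_vec e k P)
    (fun k => delta_vec g e k P) ξ).trans ?_
  simp only [dChart_dp_vec he hP, dChart_delta_vec g he hP, hDp]
  rw [flatJ]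
  simp only [sub_apply, sum_apply, ContinuousLinearMap.smulRight_apply, flatVer_eq_sum]
  rfl

omit [IsManifold 𝓘(ℝ, E n) ∞ M] in
theorem contDiffAt_transition (he : e ∈ IsManifold.maximalAtlas 𝓘(ℝ, E n) ∞ M)
    (he' : e' ∈ IsManifold.maximalAtlas 𝓘(ℝ, E n) ∞ M) {q : E n} (hq : q ∈ e.target)
    (hq' : e.symm q ∈ e'.source) : ContDiffAt ℝ ∞ (fun y => e' (e.symm y)) q :=
  ((contMDiffAt_of_mem_maximalAtlas he' hq').comp q
    (contMDiffAt_symm_of_mem_maximalAtlas he hq)).contDiffAt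

omit [IsManifold 𝓘(ℝ, E n) ∞ M] in
theorem mfderiv_coordVec_transition (he : e ∈ IsManifold.maximalAtlas 𝓘(ℝ, E n) ∞ M)
    (he' : e' ∈ IsManifold.maximalAtlas 𝓘(ℝ, E n) ∞ M) {x : M} (hx : x ∈ e.source)
    (hx' : x ∈ e'.source) (i : Fin n) :
    mfderiv 𝓘(ℝ, E n) 𝓘(ℝ, E n) e' x (coordVec e i x)
      = fderiv ℝ (fun y => e' (e.symm y)) (e x) (stdVec i) := by
  have h1 : e' =ᶠ[𝓝 x] (fun y => e' (e.symm y)) ∘ e := by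
    filter_upwards [e.open_source.mem_nhds hx] with y hy
    simp [e.left_inv hy]
  have h2 := contDiffAt_transition he he' (e.map_source hx) (by rwa [e.left_inv hx])
  have h3 := mfderiv_comp x (I' := 𝓘(ℝ, E n)) (I'' := 𝓘(ℝ, E n)) (g := fun y => e' (e.symm y))
    (h2.contMDiffAt.mdifferentiableAt (by simp))
    ((contMDiffAt_of_mem_maximalAtlas he hx).mdifferentiableAt (by simp))
  have h4 := (h1.mfderiv_eq (I := 𝓘(ℝ, E n)) (I' := 𝓘(ℝ, E n))).trans h3
  have h5 := congrArg (fun f => f (coordVec e i x)) h4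
  refine h5.trans ?_
  change mfderiv 𝓘(ℝ, E n) 𝓘(ℝ, E n) (fun y => e' (e.symm y)) (e x)
    (mfderiv 𝓘(ℝ, E n) 𝓘(ℝ, E n) e x (coordVec e i x)) = _
  rw [mfderiv_coordVec he hx]
  exact congrArg (fun f : E n →L[ℝ] E n => f (stdVec i)) mfderiv_eq_fderiv

omit [IsManifold 𝓘(ℝ, E n) ∞ M] in
theorem coordVec_transition (he : e ∈ IsManifold.maximalAtlas 𝓘(ℝ, E n) ∞ M)
    (he' : e' ∈ IsManifold.maximalAtlas 𝓘(ℝ, E n) ∞ M) {x : M} (hx : x ∈ e.source)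
    (hx' : x ∈ e'.source) (i : Fin n) :
    coordVec e i x = ∑ c, jacobian (fun y => e' (e.symm y)) (e x) c i • coordVec e' c x := by
  rw [eq_sum_coordVec he' hx' (coordVec e i x)]
  refine Finset.sum_congr rfl fun c _ => congrArg (· • _) ?_
  have h2 := contDiffAt_transition he he' (e.map_source hx) (by rwa [e.left_inv hx])
  have h3 := fderiv_apply_eq_sum_jacobian (h2.differentiableAt (by simp)) (stdVec i) c
  rw [← mfderiv_coordVec_transition he he' hx hx'] at h3
  refine h3.trans ?_
  simp [stdVec]

theorem fibreCoord_transition (he : e ∈ IsManifold.maximalAtlas 𝓘(ℝ, E n) ∞ M)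
    (he' : e' ∈ IsManifold.maximalAtlas 𝓘(ℝ, E n) ∞ M) {P : Cotangent n M} (hP : P.1 ∈ e.source)
    (hP' : P.1 ∈ e'.source) (i : Fin n) :
    fibreCoord e i P
      = ∑ c, jacobian (fun y => e' (e.symm y)) (e P.1) c i * fibreCoord e' c P := by
  simp only [fibreCoord]
  rw [coordVec_transition he he' hP hP', map_sum]
  simp only [map_smul, smul_eq_mul]

theorem gLow_apply (g : Metric n M) {x : M} (hx : x ∈ e.source) (i j : Fin n) :
    gLow g e (e x) i j = g.inner x (coordVec e i x) (coordVec e j x) := by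
  simp only [gLow, Matrix.of_apply]
  rw [e.left_inv hx]

theorem gLow_transition (g : Metric n M) (he : e ∈ IsManifold.maximalAtlas 𝓘(ℝ, E n) ∞ M)
    (he' : e' ∈ IsManifold.maximalAtlas 𝓘(ℝ, E n) ∞ M) {q : E n} (hq : q ∈ e.target)
    (hq' : e.symm q ∈ e'.source) :
    gLow g e q = (jacobian (fun y => e' (e.symm y)) q).transpose * gLow g e' (e' (e.symm q))
      * jacobian (fun y => e' (e.symm y)) q := by
  ext i j
  have hx := e.map_target hq
  have h1 : ∀ i, coordVec e i (e.symm q)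
      = ∑ c, jacobian (fun y => e' (e.symm y)) q c i • coordVec e' c (e.symm q) := fun i => by
    rw [coordVec_transition he he' hx hq', e.right_inv hq]
  simp only [Matrix.mul_apply, Matrix.transpose_apply, gLow_apply g hq', Finset.sum_mul]
  simp only [gLow, Matrix.of_apply, h1, sum_smul_coordVec_inner]
  rw [Finset.sum_comm]
  exact Finset.sum_congr rfl fun c _ => Finset.sum_congr rfl fun d _ => by ring

/-- `det(Bᵀ a' B) = det a ≠ 0` forces `det B ≠ 0`, with no use of the inverse transition map. -/
theorem isUnit_det_jacobian (g : Metric n M) (he : e ∈ IsManifold.maximalAtlas 𝓘(ℝ, E n) ∞ M)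
    (he' : e' ∈ IsManifold.maximalAtlas 𝓘(ℝ, E n) ∞ M) {q : E n} (hq : q ∈ e.target)
    (hq' : e.symm q ∈ e'.source) : IsUnit (jacobian (fun y => e' (e.symm y)) q).det := by
  have h1 := (gLow_posDef g he hq).det_pos.ne'
  rw [gLow_transition g he he' hq hq', Matrix.det_mul] at h1
  exact (right_ne_zero_of_mul h1).isUnit

theorem sum_jacobian_contraction (B : Fin n → Fin n → ℝ) (G : Fin n → Fin n → Fin n → ℝ)
    (p w : Fin n → ℝ) (i : Fin n) :
    ∑ d, B d i * ∑ m, (∑ c, p c * G c d m) * ∑ k, B m k * w k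
      = ∑ c, p c * ∑ k, ∑ d, ∑ m, B d i * B m k * G c d m * w k := by
  have h1 : ∀ c, ∑ k, ∑ d, ∑ m, B d i * B m k * G c d m * w k
      = ∑ d, ∑ m, B d i * G c d m * ∑ k, B m k * w k := by
    intro c
    rw [Finset.sum_comm]
    refine Finset.sum_congr rfl fun d _ => ?_
    rw [Finset.sum_comm]
    refine Finset.sum_congr rfl fun m _ => ?_
    rw [Finset.mul_sum]
    exact Finset.sum_congr rfl fun k _ => by ring
  simp only [h1]
  have h2 : ∀ W : Fin n → ℝ, ∑ d, B d i * ∑ m, (∑ c, p c * G c d m) * W m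
      = ∑ c, p c * ∑ d, ∑ m, B d i * G c d m * W m := by
    intro W
    simp only [Finset.mul_sum, Finset.sum_mul]
    have h3 : ∀ d, ∑ m, ∑ c, B d i * (p c * G c d m * W m)
        = ∑ c, ∑ m, B d i * (p c * G c d m * W m) := fun d => Finset.sum_comm
    simp only [h3]
    rw [Finset.sum_comm]
    exact Finset.sum_congr rfl fun c _ => Finset.sum_congr rfl fun d _ =>
      Finset.sum_congr rfl fun m _ => by ring
  exact h2 _

theorem dChart_transition (he : e ∈ IsManifold.maximalAtlas 𝓘(ℝ, E n) ∞ M)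
    (he' : e' ∈ IsManifold.maximalAtlas 𝓘(ℝ, E n) ∞ M) {P : Cotangent n M} (hP : P.1 ∈ e.source)
    (hP' : P.1 ∈ e'.source) :
    DifferentiableAt ℝ (fun z => cotChart e' (cotChartSymm e z : Cotangent n M)) (cotChart e P) ∧
    ∀ ξ, dChart e' P ξ = fderiv ℝ (fun z => cotChart e' (cotChartSymm e z : Cotangent n M))
      (cotChart e P) (dChart e P ξ) := by
  have hPP := cotChartSymm_cotChart he hP
  have h0 : ContMDiffAt (IT n) 𝓘(ℝ, E n × E n) ∞ (cotChart e')
      (cotChartSymm e (cotChart e P) : Cotangent n M) := by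
    rw [hPP]
    exact contMDiffAt_cotChart he' hP'
  have h2 : ContMDiffAt 𝓘(ℝ, E n × E n) 𝓘(ℝ, E n × E n) ∞
      (fun z => cotChart e' (cotChartSymm e z : Cotangent n M)) (cotChart e P) :=
    h0.comp (cotChart e P) (contMDiffAt_cotChartSymm (M := M) he (e.map_source hP))
  refine ⟨h2.contDiffAt.differentiableAt (by simp), fun ξ => ?_⟩
  have h1 : cotChart e' =ᶠ[𝓝 P]
      (fun z => cotChart e' (cotChartSymm e z : Cotangent n M)) ∘ cotChart e := by
    filter_upwards [eventually_mem_source hP] with Q hQ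
    simp [cotChartSymm_cotChart he hQ]
  have h3 := mfderiv_comp P (I' := 𝓘(ℝ, E n × E n)) (I'' := 𝓘(ℝ, E n × E n))
    (g := fun z => cotChart e' (cotChartSymm e z : Cotangent n M))
    (h2.mdifferentiableAt (by simp)) ((contMDiffAt_cotChart he hP).mdifferentiableAt (by simp))
  have h4 := (h1.mfderiv_eq (I := IT n) (I' := 𝓘(ℝ, E n × E n))).trans h3
  have h5 := congrArg (fun f => f ξ) h4
  refine h5.trans ?_
  exact congrArg (fun f : E n × E n →L[ℝ] E n × E n => f (dChart e P ξ)) mfderiv_eq_fderiv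

/-- The endomorphism `J` does not depend on the chart. -/
theorem JChart_eq (g : Metric n M) (A : ℝ) (v : ℝ → ℝ)
    (he : e ∈ IsManifold.maximalAtlas 𝓘(ℝ, E n) ∞ M)
    (he' : e' ∈ IsManifold.maximalAtlas 𝓘(ℝ, E n) ∞ M) {P : Cotangent n M} (hP : P.1 ∈ e.source)
    (hP' : P.1 ∈ e'.source) : JChart g A v e P = JChart g A v e' P := by
  set z := cotChart e P with hz
  set z' := cotChart e' P with hz'
  have hzU : z.1 ∈ e.target := e.map_source hP
  have hzU' : z'.1 ∈ e'.target := e'.map_source hP'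
  set φ : E n → E n := fun y => e' (e.symm y) with hφ
  set ρ : E n × E n → E n × E n := fun y => cotChart e' (cotChartSymm e y : Cotangent n M) with hρ
  have hxz : e.symm z.1 = P.1 := e.left_inv hP
  have hq' : e.symm z.1 ∈ e'.source := by rwa [hxz]
  have hφz : φ z.1 = z'.1 := congrArg e' hxz
  obtain ⟨hρd, hρD⟩ := dChart_transition he he' hP hP'
  have hφc : ContDiffAt ℝ ∞ φ z.1 := contDiffAt_transition he he' hzU hq'
  have hρz : ρ z = z' := by simp only [hρ, hz, hz', cotChartSymm_cotChart he hP]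
  have hev : ∀ᶠ y in 𝓝 z, y.1 ∈ e.target ∧ e.symm y.1 ∈ e'.source := by
    have := e.continuousAt_symm hzU (e'.open_source.mem_nhds hq')
    filter_upwards [(e.open_target.preimage continuous_fst).mem_nhds hzU,
      continuous_fst.continuousAt this] with y h1 h2 using ⟨h1, h2⟩
  have hev' : ∀ᶠ y in 𝓝 z.1, y ∈ e.target ∧ e.symm y ∈ e'.source := by
    filter_upwards [e.open_target.mem_nhds hzU,
      e.continuousAt_symm hzU (e'.open_source.mem_nhds hq')] with y h1 h2 using ⟨h1, h2⟩
  -- The law `p_i = B^c_i p'_c` is needed on a neighbourhood, because `hL2` differentiates it.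
  have hrel : ∀ᶠ y in 𝓝 z, ∀ i, y.2 i = ∑ c, jacobian φ y.1 c i * (ρ y).2 c := by
    filter_upwards [hev] with y hy i
    have h1 := fibreCoord_transition he he' (P := (cotChartSymm e y : Cotangent n M))
      (e.map_target hy.1) hy.2 i
    have h2 : fibreCoord e i (cotChartSymm e y : Cotangent n M) = y.2 i :=
      congrArg (fun y => y.2 i) (cotChart_cotChartSymm (M := M) he hy.1)
    have h3 : e (cotChartSymm e y : Cotangent n M).1 = y.1 := e.right_inv hy.1
    rw [h2, h3] at h1
    exact h1
  have hρd2 : ∀ c, HasFDerivAt (fun y => (ρ y).2 c)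
      (((EuclideanSpace.proj c).comp (ContinuousLinearMap.snd ℝ (E n) (E n))).comp
        (fderiv ℝ ρ z)) z := fun c => by
    exact (hasFDerivAt_snd_apply c (ρ z)).comp z hρd.hasFDerivAt
  have hjac : ∀ c i, DifferentiableAt ℝ (fun y => jacobian φ y c i) z.1 := fun c i =>
    (contDiffAt_jacobian hφc c i).differentiableAt (by simp)
  have hL2 : ∀ w i, w.2 i = ∑ c, (fderiv ℝ (fun y => jacobian φ y c i) z.1 w.1 * z'.2 c
      + jacobian φ z.1 c i * (fderiv ℝ ρ z w).2 c) := by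
    intro w i
    have h1 := HasFDerivAt.fun_sum (u := Finset.univ) fun c _ =>
      (hasFDerivAt_comp_fst (hjac c i)).fun_mul (hρd2 c)
    have h2 : (fun y : E n × E n => y.2 i) =ᶠ[𝓝 z]
        fun y => ∑ c, jacobian φ y.1 c i * (ρ y).2 c := by
      filter_upwards [hrel] with y hy using hy i
    have h3 := (h1.congr_of_eventuallyEq h2).unique (hasFDerivAt_snd_apply i z)
    have h4 := congrArg (fun f => f w) h3
    refine h4.symm.trans ?_
    simp only [sum_apply]
    refine Finset.sum_congr rfl fun c _ => ?_
    rw [← hρz]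
    simp
    ring
  have hL1 : ∀ w c, (fderiv ℝ ρ z w).1 c = ∑ i, jacobian φ z.1 c i * w.1 i := by
    intro w c
    rw [← fderiv_apply_eq_sum_jacobian (hφc.differentiableAt (by simp))]
    have h1 : HasFDerivAt (fun y => (ρ y).1) _ z :=
      (hasFDerivAt_fst (p := ρ z)).comp z hρd.hasFDerivAt
    have h2 : HasFDerivAt (fun y : E n × E n => φ y.1) _ z :=
      (hφc.differentiableAt (by simp)).hasFDerivAt.comp z hasFDerivAt_fst
    have h3 := congrArg (fun f => f w) (h1.unique h2)
    exact congrArg (fun y : E n => y c) h3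
  have hLC := isLeviCivita g he
  have hLC' := isLeviCivita g he'
  have hΓ := sum_jacobian_mul_christoffel hLC hLC' (fun k i j => rfl) hzU (φ := φ)
    (hφz ▸ hzU') hφc (isUnit_det_jacobian g he he' hzU hq')
    (by filter_upwards [hev'] with y hy using gLow_transition g he he' hy.1 hy.2)
  have hp := hρz ▸ hrel.self_of_nhds
  -- `Dp_i` is tensorial although `dp_i` is not: the second derivatives of the transition map in
  -- `hL2` cancel the inhomogeneous term of the Christoffel law.
  have hLD : ∀ w i, flatDp (christoffel g e) i z w
      = ∑ c, jacobian φ z.1 c i * flatDp (christoffel g e') c z' (fderiv ℝ ρ z w) := by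
    intro w i
    simp only [flatDp_apply, hL1]
    have hΓ0 : ∀ j, flatChristoffelZero (christoffel g e) i j z
        = ∑ c, z'.2 c * (pderiv j (fun y => jacobian φ y c i) z.1
          + ∑ d, ∑ m, jacobian φ z.1 d i * jacobian φ z.1 m j *
            christoffel g e' c d m z'.1) := by
      intro j
      rw [flatChristoffelZero]
      simp only [hp, Finset.sum_mul]
      rw [Finset.sum_comm]
      refine Finset.sum_congr rfl fun c _ => ?_
      have := hΓ c i j
      rw [pderiv_jacobian_comm hφc, hφz] at this
      rw [← this, Finset.mul_sum]
      exact Finset.sum_congr rfl fun k _ => by ring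
    rw [hL2 w i]
    have e1 : ∀ c, fderiv ℝ (fun y => jacobian φ y c i) z.1 w.1
        = ∑ j, w.1 j * pderiv j (fun y => jacobian φ y c i) z.1 := fun c =>
      fderiv_apply_eq_sum_pderiv _
    have e2 : ∑ j, flatChristoffelZero (christoffel g e) i j z * w.1 j
        = ∑ c, (fderiv ℝ (fun y => jacobian φ y c i) z.1 w.1 * z'.2 c
          + jacobian φ z.1 c i * ∑ j, flatChristoffelZero (christoffel g e') c j z'
            * ∑ i, jacobian φ z.1 j i * w.1 i) := by
      have e3 : ∑ c, jacobian φ z.1 c i * ∑ j, flatChristoffelZero (christoffel g e') c j z'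
            * ∑ i, jacobian φ z.1 j i * w.1 i
          = ∑ c, z'.2 c * ∑ k, ∑ d, ∑ m, jacobian φ z.1 d i * jacobian φ z.1 m k *
            christoffel g e' c d m z'.1 * w.1 k := by
        exact sum_jacobian_contraction _ _ _ _ i
      rw [Finset.sum_add_distrib, e3, ← Finset.sum_add_distrib]
      simp only [hΓ0, Finset.sum_mul]
      rw [Finset.sum_comm]
      refine Finset.sum_congr rfl fun c _ => ?_
      rw [e1, Finset.sum_mul, Finset.mul_sum, ← Finset.sum_add_distrib]
      refine Finset.sum_congr rfl fun k _ => ?_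
      simp only [← Finset.sum_mul]
      ring
    rw [e2, ← Finset.sum_sub_distrib]
    exact Finset.sum_congr rfl fun c _ => by ring
  have key := flatJ_transition (A := A) (v := v) hLC hLC' hzU hzU'
    (isUnit_det_jacobian g he he' hzU hq')
    (by rw [gLow_transition g he he' hzU hq']; exact congrArg (fun y => _ * gLow g e' y * _) hφz)
    hp (fderiv ℝ ρ z) hL1 hLD
  ext ξ
  obtain ⟨f, hf⟩ := isInvertible_dChart he' hP'
  apply f.injective
  have hf' : ∀ u, f u = dChart e' P u := fun u => by rw [← hf]; rfl
  rw [hf', hf', dChart_JChart g A v he' hP', hρD, dChart_JChart g A v he hP, hρD]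
  exact key _

end Transition

/-! ### Transfer of brackets and of the Nijenhuis tensor to `T*M`. -/

section Transfer

variable {n : ℕ} {M : Type*} [TopologicalSpace M] [ChartedSpace (E n) M]
  [IsManifold 𝓘(ℝ, E n) ∞ M] {e : OpenPartialHomeomorph M (E n)}

/-- The vector field on `T*M` with the coordinate expression `X`. -/
def fieldOfChart (e : OpenPartialHomeomorph M (E n)) (X : E n × E n → E n × E n)
    (P : Cotangent n M) : TangentSpace (IT n) P :=
  (dChart e P).inverse (X (cotChart e P))

theorem dChart_inverse (he : e ∈ IsManifold.maximalAtlas 𝓘(ℝ, E n) ∞ M) {P : Cotangent n M}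
    (hP : P.1 ∈ e.source) (u : E n × E n) : dChart e P ((dChart e P).inverse u) = u :=
  ((isInvertible_dChart he hP).inverse_apply_eq.1 rfl).symm

theorem dChart_injective (he : e ∈ IsManifold.maximalAtlas 𝓘(ℝ, E n) ∞ M) {P : Cotangent n M}
    (hP : P.1 ∈ e.source) : Function.Injective (dChart e P) :=
  (isInvertible_dChart he hP).injective

theorem mlieBracket_vectorSpace {F : Type*} [NormedAddCommGroup F] [NormedSpace ℝ F]
    (V W : (x : F) → TangentSpace 𝓘(ℝ, F) x) (x : F) :
    mlieBracket 𝓘(ℝ, F) V W x = lieBracket ℝ V W x := by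
  rw [← mlieBracketWithin_univ, mlieBracketWithin_eq_lieBracketWithin]
  exact congrFun lieBracketWithin_univ x

/-- Naturality of the Lie bracket under pullback by `cotChart e`: `fieldOfChart e X'` is the
pullback of `X'`. -/
theorem dChart_mlieBracket (he : e ∈ IsManifold.maximalAtlas 𝓘(ℝ, E n) ∞ M)
    {P : Cotangent n M} (hP : P.1 ∈ e.source) {X Y : (P : Cotangent n M) → TangentSpace (IT n) P}
    {X' Y' : E n × E n → E n × E n}
    (hX : ∀ᶠ Q in 𝓝 P, X Q = fieldOfChart e X' Q) (hY : ∀ᶠ Q in 𝓝 P, Y Q = fieldOfChart e Y' Q)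
    (hX' : DifferentiableAt ℝ X' (cotChart e P)) (hY' : DifferentiableAt ℝ Y' (cotChart e P)) :
    dChart e P (mlieBracket (IT n) X Y P) = lieBracket ℝ X' Y' (cotChart e P) := by
  have h1 : ∀ {Z : E n × E n → E n × E n}, DifferentiableAt ℝ Z (cotChart e P) →
      MDifferentiableAt 𝓘(ℝ, E n × E n) (𝓘(ℝ, E n × E n).tangent)
        (fun y => (⟨y, Z y⟩ : TangentBundle 𝓘(ℝ, E n × E n) (E n × E n))) (cotChart e P) := by
    intro Z hZ
    rw [mdifferentiableAt_totalSpace]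
    refine ⟨mdifferentiableAt_id, ?_⟩
    simpa using hZ.mdifferentiableAt
  have hM : IsManifold (IT n) ∞ (Cotangent n M) := inferInstance
  have hM2 : IsManifold (IT n) (minSmoothness ℝ 2) (Cotangent n M) := by
    refine IsManifold.of_le (n := ∞) ?_
    rw [minSmoothness_of_isRCLikeNormedField]
    exact WithTop.coe_le_coe.2 (le_top : (2 : ℕ∞) ≤ ⊤)
  have h2 := mpullback_mlieBracket (I := IT n) (I' := 𝓘(ℝ, E n × E n)) (n := ∞)
    (f := cotChart e) (V := X') (W := Y') (x₀ := P) (h1 hX') (h1 hY') (contMDiffAt_cotChart he hP)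
    (by
      rw [minSmoothness_of_isRCLikeNormedField]
      exact WithTop.coe_le_coe.2 (le_top : (2 : ℕ∞) ≤ ⊤))
  rw [EventuallyEq.mlieBracket_vectorField_eq (V := mpullback (IT n) 𝓘(ℝ, E n × E n) (cotChart e) X')
    (W := mpullback (IT n) 𝓘(ℝ, E n × E n) (cotChart e) Y') hX hY, ← h2]
  exact (dChart_inverse he hP _).trans (mlieBracket_vectorSpace _ _ _)

theorem map_sub_sub_sub {V W : Type*} [AddCommGroup V] [Module ℝ V] [TopologicalSpace V]
    [AddCommGroup W] [Module ℝ W] [TopologicalSpace W] (L : V →L[ℝ] W) (x y z w : V) :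
    L (x - y - z - w) = L x - L y - L z - L w := by
  simp only [map_sub]

theorem map_sum_smul {V W : Type*} [AddCommGroup V] [Module ℝ V] [TopologicalSpace V]
    [AddCommGroup W] [Module ℝ W] [TopologicalSpace W] (L : V →L[ℝ] W) (c : Fin n → ℝ)
    (X : Fin n → V) : L (∑ k, c k • X k) = ∑ k, c k • L (X k) := by
  simp only [map_sum, map_smul]

theorem dChart_nijenhuis (he : e ∈ IsManifold.maximalAtlas 𝓘(ℝ, E n) ∞ M)
    {P : Cotangent n M} (hP : P.1 ∈ e.source)
    {K : (P : Cotangent n M) → TangentSpace (IT n) P →L[ℝ] TangentSpace (IT n) P}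
    {J' : E n × E n → E n × E n →L[ℝ] E n × E n}
    (hK : ∀ᶠ Q in 𝓝 P, ∀ ξ, dChart e Q (K Q ξ) = J' (cotChart e Q) (dChart e Q ξ))
    {X' Y' : E n × E n → E n × E n}
    (hX' : DifferentiableAt ℝ X' (cotChart e P)) (hY' : DifferentiableAt ℝ Y' (cotChart e P))
    (hJX' : DifferentiableAt ℝ (fun y => J' y (X' y)) (cotChart e P))
    (hJY' : DifferentiableAt ℝ (fun y => J' y (Y' y)) (cotChart e P)) :
    dChart e P (nijenhuis K (fieldOfChart e X') (fieldOfChart e Y') P)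
      = flatNijenhuis J' X' Y' (cotChart e P) := by
  have h1 : ∀ Z : E n × E n → E n × E n, ∀ᶠ Q in 𝓝 P, fieldOfChart e Z Q = fieldOfChart e Z Q :=
    fun Z => Eventually.of_forall fun _ => rfl
  have h2 : ∀ Z : E n × E n → E n × E n,
      ∀ᶠ Q in 𝓝 P, K Q (fieldOfChart e Z Q) = fieldOfChart e (fun y => J' y (Z y)) Q := by
    intro Z
    filter_upwards [eventually_mem_source hP, hK] with Q hQ hKQ
    apply dChart_injective he hQ
    rw [hKQ, fieldOfChart, fieldOfChart, dChart_inverse he hQ, dChart_inverse he hQ]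
  have hKP := hK.self_of_nhds
  refine (map_sub_sub_sub (dChart e P) _ _ _ _).trans ?_
  rw [hKP, hKP, dChart_mlieBracket he hP (h2 X') (h2 Y') hJX' hJY',
    dChart_mlieBracket he hP (h2 X') (h1 Y') hJX' hY',
    dChart_mlieBracket he hP (h1 X') (h2 Y') hX' hJY',
    dChart_mlieBracket he hP (h1 X') (h1 Y') hX' hY', flatNijenhuis]

theorem cotChart_snd_ne_zero (he : e ∈ IsManifold.maximalAtlas 𝓘(ℝ, E n) ∞ M)
    {P : Cotangent n M} (hPe : P.1 ∈ e.source) (hP : P.2 ≠ 0) : (cotChart e P).2 ≠ 0 := by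
  intro h
  apply hP
  ext u
  rw [eq_sum_coordVec he hPe u, map_sum]
  refine (Finset.sum_eq_zero fun i _ => ?_).trans (zero_apply _).symm
  have h2 : P.2 (coordVec e i P.1) = 0 := congrArg (fun y : E n => y i) h
  rw [map_smul, h2, smul_zero]

end Transfer

end CotangentNijenhuis

end

/-! ### The theorem on `T*M`. -/

open CotangentNijenhuis

theorem theorem2 {n : ℕ} {M : Type*} [TopologicalSpace M]
    [ChartedSpace (CotangentNijenhuis.E n) M]
    [IsManifold 𝓘(ℝ, CotangentNijenhuis.E n) ∞ M]
    (g : CotangentNijenhuis.Metric n M)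
    (A : ℝ) (hA : A ≠ 0)
    (v : ℝ → ℝ) (hv : ContDiffOn ℝ ∞ v (Set.Ioi 0))
    (e : OpenPartialHomeomorph M (CotangentNijenhuis.E n))
    (he : e ∈ IsManifold.maximalAtlas 𝓘(ℝ, CotangentNijenhuis.E n) ∞ M)
    (P : CotangentNijenhuis.Cotangent n M) (hPe : P.1 ∈ e.source) (hP : P.2 ≠ 0)
    (hAv : A + 2 * v (CotangentNijenhuis.energy g e P) ≠ 0) (i j : Fin n) :
    CotangentNijenhuis.nijenhuis (CotangentNijenhuis.J g A v)
        (CotangentNijenhuis.delta_vec g e i) (CotangentNijenhuis.delta_vec g e j) P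
      = ∑ k, CotangentNijenhuis.T g A v e k i j P • CotangentNijenhuis.dp_vec e k P ∧
    CotangentNijenhuis.nijenhuis (CotangentNijenhuis.J g A v)
        (CotangentNijenhuis.delta_vec g e i) (CotangentNijenhuis.dp_vec e j) P
      = ∑ k, (∑ l, ∑ r, CotangentNijenhuis.HUp g A v e k l P
            * CotangentNijenhuis.HUp g A v e j r P * CotangentNijenhuis.T g A v e l i r P)
          • CotangentNijenhuis.delta_vec g e k P ∧
    CotangentNijenhuis.nijenhuis (CotangentNijenhuis.J g A v)
        (CotangentNijenhuis.dp_vec e i) (CotangentNijenhuis.dp_vec e j) P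
      = ∑ k, (∑ l, ∑ r, CotangentNijenhuis.HUp g A v e i r P
            * CotangentNijenhuis.HUp g A v e j l P * CotangentNijenhuis.T g A v e k l r P)
          • CotangentNijenhuis.dp_vec e k P := by
  set z := cotChart e P with hz
  have hzU : z.1 ∈ e.target := e.map_source hPe
  have hLC := isLeviCivita g he
  have ht : 0 < flatEnergy (gUp g e) z :=
    flatEnergy_pos rfl (gLow_posDef g he hzU) (cotChart_snd_ne_zero he hPe hP)
  have hvd : DifferentiableAt ℝ v (flatEnergy (gUp g e) z) :=
    (hv.contDiffAt (Ioi_mem_nhds ht)).differentiableAt (by simp)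
  have hJ : ∀ᶠ Q in 𝓝 P, ∀ ξ, dChart e Q (J g A v Q ξ)
      = flatJ (gLow g e) (gUp g e) (christoffel g e) A v (cotChart e Q) (dChart e Q ξ) := by
    filter_upwards [eventually_mem_source hPe] with Q hQ ξ
    -- The preferred chart depends on `Q`; it is exchanged here for the fixed `e`, uniformly in `Q`
    -- near `P`.
    rw [J, JChart_eq g A v (IsManifold.chart_mem_maximalAtlas Q.1) he (mem_chart_source _ Q.1) hQ]
    exact dChart_JChart g A v he hQ ξ
  have hev := eventually_nondegenerate hLC hzU ht.ne' hAv hvd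
  have hdelta : ∀ i, delta_vec g e i = fieldOfChart e (flatHor (christoffel g e) i) := fun i =>
    funext fun Q => delta_vec_eq g i Q
  have hdp : ∀ i, dp_vec (M := M) e i = fieldOfChart e (fun _ => (0, stdVec i)) := fun i => rfl
  have hhor : ∀ i, DifferentiableAt ℝ (flatHor (christoffel g e) i) z := fun i =>
    differentiableAt_flatVer (differentiableAt_flatChristoffelZero hLC hzU i) _
  have hver : ∀ i, DifferentiableAt ℝ (fun _ : E n × E n => ((0, stdVec i) : E n × E n)) z :=
    fun i => differentiableAt_const _
  have hJhor : ∀ i, DifferentiableAt ℝ (fun y => flatJ (gLow g e) (gUp g e) (christoffel g e) A v y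
      (flatHor (christoffel g e) i y)) z := by
    intro i
    refine (differentiableAt_flatVer (differentiableAt_flatG (A := A) hLC hzU hvd i)
      0).congr_of_eventuallyEq ?_
    filter_upwards [hev] with y hy using flatJ_flatHor hLC hy.1 i
  have hJver : ∀ i, DifferentiableAt ℝ (fun y => flatJ (gLow g e) (gUp g e) (christoffel g e) A v y
      ((0, stdVec i) : E n × E n)) z := by
    intro i
    -- `∂/∂p_i` is written as a vertical vector with constant components, so its `J`-image is a
    -- combination of horizontal fields with coefficients from `H`.
    simp only [← flatVer_single, flatJ_flatVer]
    exact (DifferentiableAt.fun_sum fun j _ => (DifferentiableAt.fun_sum fun k _ =>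
      (differentiableAt_flatH hLC hzU hA ht.ne' hAv hvd j k).fun_smul (hhor k)).const_smul
      ((1 : Matrix (Fin n) (Fin n) ℝ) i j)).fun_neg
  have hinj := dChart_injective he hPe
  refine ⟨hinj ?_, hinj ?_, hinj ?_⟩
  · rw [hdelta, hdelta, dChart_nijenhuis he hPe hJ (hhor i) (hhor j) (hJhor i) (hJhor j),
      map_sum_smul, flatNijenhuis_flatHor_flatHor hLC hzU hvd, flatVer_eq_sum]
    simp only [dChart_dp_vec he hPe]
    rfl
  · rw [hdelta, hdp, dChart_nijenhuis he hPe hJ (hhor i) (hver j) (hJhor i) (hJver j),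
      map_sum_smul, flatNijenhuis_flatHor_ver hLC hzU hA ht.ne' hAv hvd]
    simp only [dChart_delta_vec g he hPe]
    rfl
  · rw [hdp, hdp, dChart_nijenhuis he hPe hJ (hver i) (hver j) (hJver i) (hJver j),
      map_sum_smul, flatNijenhuis_ver_ver hLC hzU hA ht.ne' hAv hvd, flatVer_eq_sum]
    simp only [dChart_dp_vec he hPe]
    rfl
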